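/- Let $\lambda > 0$. A convex body in $\mathbb{R}^2$ is a compact convex set with non-empty interior. A convex body $K \subset \mathbb{R}^2$ is called $\lambda$-convex if for every $p \in \partial K$ there are a neighborhood $U_p$ of $p$ in $\mathbb{R}^2$ and a closed disc $B$ of radius $1/\lambda$ with $p \in \partial B$ such that $U_p \cap \partial K \subset B$. A $\lambda$-convex lens is a set with non-empty interior that is the intersection of two closed discs of radius $1/\lambda$; the two discs are allowed to coincide, so a disc of radius $1/\lambda$ counts as a (degenerate) lens. Write $|K|$ for the area of $K$ and $|\partial K|$ for the length of its boundary (which is finite). Then every $\lambda$-convex body $K \subset \mathbb{R}^2$ satisfies \[ |K| \ \ge\ \frac{|\partial K|}{2\lambda} - \frac{1}{\lambda^{2}} \sin\left(\frac{|\partial K|\,\lambda}{2}\right), \] and equality holds if and only if $K$ is a $\lambda$-convex lens. -/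

import Mathlib

open MeasureTheory Metric Topology

/-- A convex body in the Euclidean plane: a compact convex set with non-empty interior. -/
structure IsPlanarConvexBody (K : Set (EuclideanSpace ℝ (Fin 2))) : Prop where
  isCompact : IsCompact K
  convex : Convex ℝ K
  interior_nonempty : (interior K).Nonempty

/-- A convex body `K` in the plane is `lam`-convex if its boundary curvature is at least `lam` in
the barrier sense: near every boundary point `p`, the boundary lies in some closed disc of radius
`1 / lam` whose bounding circle passes through `p`. -/
structure IsLamConvexBody (lam : ℝ) (K : Set (EuclideanSpace ℝ (Fin 2))) : Prop
    extends IsPlanarConvexBody K where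
  barrier : ∀ p ∈ frontier K, ∃ U ∈ 𝓝 p, ∃ c : EuclideanSpace ℝ (Fin 2),
    p ∈ sphere c (1 / lam) ∧ U ∩ frontier K ⊆ closedBall c (1 / lam)

/-- A `lam`-convex lens: the intersection of two closed discs of radius `1 / lam`, with non-empty
interior. The two discs may coincide, so a disc of radius `1 / lam` is a (degenerate) lens. -/
def IsLamConvexLens (lam : ℝ) (L : Set (EuclideanSpace ℝ (Fin 2))) : Prop :=
  (interior L).Nonempty ∧
    ∃ a b : EuclideanSpace ℝ (Fin 2), L = closedBall a (1 / lam) ∩ closedBall b (1 / lam)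

/-- The area of a planar set: its two-dimensional Lebesgue measure. -/
noncomputable def planarArea (K : Set (EuclideanSpace ℝ (Fin 2))) : ℝ :=
  (volume K).toReal

/-- The length of the boundary of a planar set: the one-dimensional Hausdorff measure of its
topological boundary. -/
noncomputable def boundaryLength (K : Set (EuclideanSpace ℝ (Fin 2))) : ℝ :=
  (Measure.hausdorffMeasure 1 (frontier K)).toReal

/-! Parametrise the boundary of `K` by the angle `θ` of the outer normal. Blaschke's rolling theorem
makes the support point a Lipschitz function of `θ`, with derivative `ρ θ / lam` times the unit
tangent, where the density `ρ` has values in `[0, 1]`. The boundary length is then `1 / lam` times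
the mass of `ρ` over a full turn, and for every `p` the area is `1 / (2 * lam ^ 2)` times the sum,
over the half turns `[p, p + π]` and `[p + π, p + 2 * π]`, of the integral of
`ρ s * ρ t * sin (t - s)` over `s < t`. By continuity `p` can be chosen such that both half turns
have the same mass `m`.

On a half turn, `t - s` is at least the mass `u` of `[s, t]`, and it exceeds `u` by at most `π - m`.
Concavity bounds `sin (t - s)` from below by the chord of the sine over `[u, u + π - m]`, and the
integral of this chord is `m - sin m` whatever `ρ` is. Summing over the two half turns gives the
inequality. Equality forces `ρ`, on each half turn, to be the indicator of an interval or of the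
complement of one; comparing the widths of the two halves excludes the second case unless it is
also of the first kind, so the boundary consists of two arcs of radius `1 / lam`.
-/

namespace LamConvex

open Set Filter Real
open scoped InnerProductSpace

section Calculus

lemma intervalIntegral_eq_sub_of_ae_hasDerivAt {f f' : ℝ → ℝ} {a b : ℝ}
    (hf : AbsolutelyContinuousOnInterval f a b) (hf' : ∀ᵐ t, HasDerivAt f (f' t) t) :
    ∫ t in a..b, f' t = f b - f a := by
  rw [← hf.integral_deriv_eq_sub]
  refine intervalIntegral.integral_congr_ae ?_
  filter_upwards [hf'] with t ht _ using ht.deriv.symm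

lemma integral_comp_mul_of_lipschitzWith {X X' g : ℝ → ℝ} {C : NNReal} (hX : LipschitzWith C X)
    (hX' : ∀ᵐ t, HasDerivAt X (X' t) t) (hg : Continuous g) (a b : ℝ) :
    ∫ t in a..b, g (X t) * X' t = ∫ x in X a..X b, g x := by
  set G : ℝ → ℝ := fun x => ∫ y in (0 : ℝ)..x, g y
  have hG (x) : HasDerivAt G (g x) x := intervalIntegral.integral_hasDerivAt_right
    (hg.intervalIntegrable _ _) (hg.stronglyMeasurableAtFilter _ _) hg.continuousAt
  have hG1 : ContDiff ℝ 1 G := contDiff_one_iff_deriv.2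
    ⟨fun x => (hG x).differentiableAt, by rwa [funext fun x => (hG x).deriv]⟩
  obtain ⟨D, hD⟩ := (hG1.locallyLipschitz.locallyLipschitzOn).exists_lipschitzOnWith_of_compact
    ((isCompact_uIcc (a := a) (b := b)).image hX.continuous)
  have hGX : AbsolutelyContinuousOnInterval (G ∘ X) a b :=
    (hD.comp hX.lipschitzOnWith (mapsTo_image X _)).absolutelyContinuousOnInterval
  rw [intervalIntegral_eq_sub_of_ae_hasDerivAt hGX
    (hX'.mono fun t ht => (hG (X t)).comp t ht)]
  exact intervalIntegral.integral_interval_sub_left (hg.intervalIntegrable _ _)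
    (hg.intervalIntegrable _ _)

lemma intervalIntegral_triangle_swap {G : ℝ → ℝ → ℝ} {a b : ℝ} (hab : a ≤ b)
    (hG : IntegrableOn (fun z : ℝ × ℝ => G z.1 z.2) (Ioc a b ×ˢ Ioc a b)) :
    ∫ t in a..b, ∫ s in a..t, G s t = ∫ s in a..b, ∫ t in s..b, G s t := by
  set T : Set (ℝ × ℝ) := {z | z.1 < z.2}
  set H : ℝ → ℝ → ℝ := fun s t => T.indicator (fun z => G z.1 z.2) (s, t)
  have hH : Integrable (Function.uncurry H)
      ((volume.restrict (Ioc a b)).prod (volume.restrict (Ioc a b))) := by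
    rw [Measure.prod_restrict]
    exact hG.integrable.indicator (measurableSet_lt measurable_fst measurable_snd)
  have lower {t} (ht : t ∈ Ioc a b) : ∫ s in a..t, G s t = ∫ s in Ioc a b, H s t := by
    rw [intervalIntegral.integral_of_le ht.1.le, integral_Ioc_eq_integral_Ioo,
      show Ioo a t = Ioc a b ∩ Iio t by grind, ← setIntegral_indicator measurableSet_Iio]
    rfl
  have upper {s} (hs : s ∈ Ioc a b) : ∫ t in s..b, G s t = ∫ t in Ioc a b, H s t := by
    rw [intervalIntegral.integral_of_le hs.2, show Ioc s b = Ioc a b ∩ Ioi s by grind,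
      ← setIntegral_indicator measurableSet_Ioi]
    rfl
  rw [intervalIntegral.integral_of_le hab, intervalIntegral.integral_of_le hab,
    setIntegral_congr_fun measurableSet_Ioc fun t => lower,
    setIntegral_congr_fun measurableSet_Ioc fun s => upper, integral_integral_swap hH]

end Calculus

/-- A density on the line with values in `[0, 1]`; in the application it is `lam` times the radius
of curvature of a `lam`-convex curve, as a function of the normal angle. -/
structure IsUnitDensity (ρ : ℝ → ℝ) : Prop where
  measurable : Measurable ρ
  nonneg : ∀ t, 0 ≤ ρ t
  le_one : ∀ t, ρ t ≤ 1

/-- The mass that the density `ρ` gives to the interval from `a` to `b`. -/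
noncomputable def mass (ρ : ℝ → ℝ) (a b : ℝ) : ℝ := ∫ s in a..b, ρ s

@[simp] lemma mass_self (ρ : ℝ → ℝ) (a : ℝ) : mass ρ a a = 0 := intervalIntegral.integral_same

namespace IsUnitDensity

variable {ρ : ℝ → ℝ} {a b c s t : ℝ}

lemma intervalIntegrable (h : IsUnitDensity ρ) (a b : ℝ) : IntervalIntegrable ρ volume a b :=
  (intervalIntegrable_const (c := (1 : ℝ))).mono_fun h.measurable.aestronglyMeasurable <|
    ae_of_all _ fun t => by simpa [abs_of_nonneg (h.nonneg t)] using h.le_one t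

lemma intervalIntegrable_mul (h : IsUnitDensity ρ) {g : ℝ → ℝ} (hg : Continuous g) (a b : ℝ) :
    IntervalIntegrable (fun s => ρ s * g s) volume a b :=
  (h.intervalIntegrable a b).mul_continuousOn hg.continuousOn

lemma mass_add_mass (h : IsUnitDensity ρ) (a b c : ℝ) : mass ρ a b + mass ρ b c = mass ρ a c :=
  intervalIntegral.integral_add_adjacent_intervals (h.intervalIntegrable a b)
    (h.intervalIntegrable b c)

lemma mass_nonneg (h : IsUnitDensity ρ) (hab : a ≤ b) : 0 ≤ mass ρ a b :=
  intervalIntegral.integral_nonneg hab fun t _ => h.nonneg t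

lemma mass_le_sub (h : IsUnitDensity ρ) (hab : a ≤ b) : mass ρ a b ≤ b - a := by
  simpa [mass] using intervalIntegral.integral_mono_on hab (h.intervalIntegrable a b)
    (intervalIntegrable_const (c := (1 : ℝ))) fun t _ => h.le_one t

lemma lipschitzWith_mass (h : IsUnitDensity ρ) (a : ℝ) : LipschitzWith 1 (mass ρ a) :=
  LipschitzWith.of_le_add_mul 1 fun s t => by
    have hadd := h.mass_add_mass a t s
    rcases le_total s t with hst | hts
    · have := h.mass_add_mass a s t
      have := h.mass_nonneg hst
      have : 0 ≤ dist s t := dist_nonneg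
      push_cast
      linarith
    · have := h.mass_le_sub hts
      have := le_abs_self (s - t)
      rw [Real.dist_eq]
      push_cast
      linarith

lemma continuous_mass (h : IsUnitDensity ρ) : Continuous fun z : ℝ × ℝ => mass ρ z.1 z.2 := by
  have : (fun z : ℝ × ℝ => mass ρ z.1 z.2) = fun z => mass ρ 0 z.2 - mass ρ 0 z.1 := by
    ext z
    linarith [h.mass_add_mass 0 z.1 z.2]
  have := (h.lipschitzWith_mass 0).continuous
  simp only [*]
  fun_prop

lemma ae_hasDerivAt_mass (h : IsUnitDensity ρ) (a : ℝ) :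
    ∀ᵐ t, HasDerivAt (mass ρ a) (ρ t) t := by
  have hloc : LocallyIntegrable ρ volume :=
    (locallyIntegrable_const (1 : ℝ)).mono h.measurable.aestronglyMeasurable <|
      ae_of_all _ fun t => by simpa [abs_of_nonneg (h.nonneg t)] using h.le_one t
  filter_upwards [LocallyIntegrable.ae_hasDerivAt_integral hloc] with t ht using ht a

lemma integral_mul_comp_mass (h : IsUnitDensity ρ) {f : ℝ → ℝ} (hf : Continuous f) (c a b : ℝ) :
    ∫ s in a..b, ρ s * f (mass ρ c s) = ∫ x in mass ρ c a..mass ρ c b, f x := by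
  simp_rw [mul_comm (ρ _)]
  exact integral_comp_mul_of_lipschitzWith (h.lipschitzWith_mass c) (h.ae_hasDerivAt_mass c) hf a b

lemma integral_mul_comp_mass_right (h : IsUnitDensity ρ) {f : ℝ → ℝ} (hf : Continuous f)
    (a b : ℝ) : ∫ s in a..b, ρ s * f (mass ρ s b) = ∫ x in (0 : ℝ)..mass ρ a b, f x := by
  have hmass : (fun s => ρ s * f (mass ρ s b)) = fun s => ρ s * f (mass ρ a b - mass ρ a s) := by
    ext s
    rw [← h.mass_add_mass a s b, add_sub_cancel_left]
  rw [hmass, h.integral_mul_comp_mass (f := fun x => f (mass ρ a b - x)) (by fun_prop),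
    intervalIntegral.integral_comp_sub_left]
  simp

lemma continuous_integral_mul (h : IsUnitDensity ρ) {g : ℝ → ℝ → ℝ}
    (hg : Continuous fun z : ℝ × ℝ => g z.1 z.2) (a : ℝ) :
    Continuous fun t => ∫ s in a..t, ρ s * g s t := by
  set μ : Measure ℝ := volume.withDensity fun t => ENNReal.ofReal (ρ t)
  have hle : μ ≤ volume := by
    simpa using withDensity_mono (μ := volume) (g := 1) <|
      ae_of_all _ fun t => by simpa using h.le_one t
  have : IsLocallyFiniteMeasure μ := Measure.isLocallyFiniteMeasure_of_le hle
  have : NullSingletonClass μ := ⟨fun x => le_antisymm ((hle _).trans (by simp)) bot_le⟩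
  have hμ (t) : ∫ s in a..t, ρ s * g s t = ∫ s in a..t, g s t ∂μ := by
    have hset (x y) : ∫ s in Ioc x y, ρ s * g s t = ∫ s in Ioc x y, g s t ∂μ := by
      rw [setIntegral_withDensity_eq_setIntegral_toReal_smul h.measurable.ennreal_ofReal
        (by simp) _ measurableSet_Ioc]
      simp [ENNReal.toReal_ofReal (h.nonneg _)]
    rw [intervalIntegral, intervalIntegral, hset, hset]
  simp_rw [hμ]
  exact intervalIntegral.continuous_parametric_intervalIntegral_of_continuous
    (f := fun t s => g s t) (hg.comp continuous_swap) continuous_id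

end IsUnitDensity

section SinChord

/-- For fixed `u`, the function of `v` whose graph is the chord of `v ↦ sin (u + v)` over the
interval from `0` to `π - l`. -/
noncomputable def sinChord (l u v : ℝ) : ℝ := sin u + v / (π - l) * (sin (l - u) - sin u)

variable {l u v : ℝ}

lemma sinChord_lt_sin (hu : 0 ≤ u) (hul : u ≤ l) (hv : 0 < v) (hvl : v < π - l) :
    sinChord l u v < sin (u + v) := by
  have hM : 0 < π - l := hv.trans hvl
  have hend : sin (u + (π - l)) = sin (l - u) := by rw [← sin_pi_sub (l - u)]; ring_nf
  have hcomb : (1 - v / (π - l)) • u + (v / (π - l)) • (u + (π - l)) = u + v := by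
    simp only [smul_eq_mul]
    field_simp
    ring
  have hconc := strictConcaveOn_sin_Icc.2 (x := u) (y := u + (π - l)) ⟨hu, by linarith⟩
    ⟨by linarith, by linarith⟩ (by linarith) (sub_pos.2 ((div_lt_one hM).2 hvl)) (div_pos hv hM)
    (by ring)
  rw [hend, hcomb] at hconc
  simp only [smul_eq_mul] at hconc
  unfold sinChord
  linarith

lemma sinChord_le_sin (hu : 0 ≤ u) (hul : u ≤ l) (hv : 0 ≤ v) (hvl : v ≤ π - l) :
    sinChord l u v ≤ sin (u + v) := by
  rcases hv.eq_or_lt with rfl | hv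
  · simp [sinChord]
  rcases hvl.eq_or_lt with rfl | hvl
  · have hend : sin (u + (π - l)) = sin (l - u) := by rw [← sin_pi_sub (l - u)]; ring_nf
    simp [sinChord, div_self hv.ne', hend]
  · exact (sinChord_lt_sin hu hul hv hvl).le

end SinChord

/-- The integral of `g` over the triangle `a < s < t < b` against the product of the measures of
density `ρ` in `s` and in `t`. -/
noncomputable def triangleIntegral (ρ : ℝ → ℝ) (a b : ℝ) (g : ℝ → ℝ → ℝ) : ℝ :=
  ∫ t in a..b, ρ t * ∫ s in a..t, ρ s * g s t

namespace IsUnitDensity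

variable {ρ : ℝ → ℝ} {a b s t : ℝ}

lemma triangleIntegral_add (h : IsUnitDensity ρ) {f g : ℝ → ℝ → ℝ}
    (hf : Continuous fun z : ℝ × ℝ => f z.1 z.2) (hg : Continuous fun z : ℝ × ℝ => g z.1 z.2)
    (a b : ℝ) : triangleIntegral ρ a b (fun s t => f s t + g s t)
      = triangleIntegral ρ a b f + triangleIntegral ρ a b g := by
  have hinner (t) : ∫ s in a..t, ρ s * (f s t + g s t)
      = (∫ s in a..t, ρ s * f s t) + ∫ s in a..t, ρ s * g s t := by
    simp_rw [mul_add]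
    exact intervalIntegral.integral_add (h.intervalIntegrable_mul (by fun_prop) a t)
      (h.intervalIntegrable_mul (by fun_prop) a t)
  simp_rw [triangleIntegral, hinner, mul_add]
  exact intervalIntegral.integral_add
    (h.intervalIntegrable_mul (h.continuous_integral_mul hf a) a b)
    (h.intervalIntegrable_mul (h.continuous_integral_mul hg a) a b)

lemma integral_mul_nonneg (h : IsUnitDensity ρ) {f : ℝ → ℝ} (hab : a ≤ b)
    (hf : ∀ s ∈ Icc a b, 0 ≤ f s) : 0 ≤ ∫ s in a..b, ρ s * f s :=
  intervalIntegral.integral_nonneg hab fun s hs => mul_nonneg (h.nonneg s) (hf s hs)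

lemma triangleIntegral_nonneg (h : IsUnitDensity ρ) {g : ℝ → ℝ → ℝ} (hab : a ≤ b)
    (hg : ∀ s t, a ≤ s → s ≤ t → t ≤ b → 0 ≤ g s t) : 0 ≤ triangleIntegral ρ a b g :=
  h.integral_mul_nonneg hab fun t ht =>
    h.integral_mul_nonneg ht.1 fun s hs => hg s t hs.1 hs.2 ht.2

lemma triangleIntegral_sin_mass (h : IsUnitDensity ρ) (a b : ℝ) :
    triangleIntegral ρ a b (fun s t => sin (mass ρ s t)) = mass ρ a b - sin (mass ρ a b) := by
  simp_rw [triangleIntegral, h.integral_mul_comp_mass_right continuous_sin]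
  rw [h.integral_mul_comp_mass (f := fun y => ∫ x in (0 : ℝ)..y, sin x)
    (intervalIntegral.continuous_primitive (fun _ _ => continuous_sin.intervalIntegrable _ _) 0)]
  simp [integral_sin, intervalIntegral.integral_sub]

lemma integrableOn_mul_mul (h : IsUnitDensity ρ) {g : ℝ → ℝ → ℝ}
    (hg : Continuous fun z : ℝ × ℝ => g z.1 z.2) (a b : ℝ) :
    IntegrableOn (fun z : ℝ × ℝ => ρ z.1 * ρ z.2 * g z.1 z.2) (Ioc a b ×ˢ Ioc a b) := by
  have hg' : IntegrableOn (fun z : ℝ × ℝ => g z.1 z.2) (Ioc a b ×ˢ Ioc a b) :=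
    (hg.continuousOn.integrableOn_compact (isCompact_Icc.prod isCompact_Icc)).mono_set
      (prod_mono Ioc_subset_Icc_self Ioc_subset_Icc_self)
  refine hg'.bdd_mul (c := 1) ((h.measurable.comp measurable_fst).mul
    (h.measurable.comp measurable_snd)).aestronglyMeasurable (ae_of_all _ fun z => ?_)
  simpa [abs_mul, abs_of_nonneg (h.nonneg _)] using
    mul_le_one₀ (h.le_one z.1) (h.nonneg z.2) (h.le_one z.2)

/-- Exchanging the order of integration in the part containing `q s` reduces the claim to the
symmetry of `y ↦ ∫ x in 0..y, k x` under `y ↦ mass ρ a b - y`. -/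
lemma triangleIntegral_sub_mul_eq_zero (h : IsUnitDensity ρ) (hab : a ≤ b) {q k : ℝ → ℝ}
    (hq : Continuous q) (hk : Continuous k) (hanti : ∀ x, k (mass ρ a b - x) = -k x) :
    triangleIntegral ρ a b (fun s t => (q t - q s) * k (mass ρ s t)) = 0 := by
  have hm := h.continuous_mass
  have hkm : Continuous fun z : ℝ × ℝ => k (mass ρ z.1 z.2) := hk.comp hm
  have hswap : ∫ t in a..b, ρ t * ∫ s in a..t, ρ s * (q s * k (mass ρ s t))
      = ∫ s in a..b, ρ s * q s * ∫ t in s..b, ρ t * k (mass ρ s t) := by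
    simp_rw [← intervalIntegral.integral_const_mul]
    rw [← intervalIntegral_triangle_swap hab]
    · exact intervalIntegral.integral_congr fun t _ =>
        intervalIntegral.integral_congr fun s _ => by ring
    · exact (h.integrableOn_mul_mul (g := fun s t => q s * k (mass ρ s t)) (by fun_prop)
        a b).congr_fun (fun z _ => by ring) (measurableSet_Ioc.prod measurableSet_Ioc)
  have hprim (y z : ℝ) : ∫ x in y..z, k x = -∫ x in mass ρ a b - z..mass ρ a b - y, k x := by
    simp [← intervalIntegral.integral_comp_sub_left, hanti]
  have hinner (t) : ∫ s in t..b, ρ s * k (mass ρ t s) = ∫ s in a..t, ρ s * k (mass ρ s t) := by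
    have htotal : ∫ x in (0 : ℝ)..mass ρ a b, k x = 0 := by
      have := hprim 0 (mass ρ a b)
      simp only [sub_self, sub_zero] at this
      linarith
    have hsplit := intervalIntegral.integral_add_adjacent_intervals
      (hk.intervalIntegrable (μ := volume) 0 (mass ρ a t)) (hk.intervalIntegrable _ (mass ρ a b))
    rw [h.integral_mul_comp_mass_right hk, h.integral_mul_comp_mass hk, mass_self, hprim,
      sub_zero, show mass ρ a b - mass ρ t b = mass ρ a t by linarith [h.mass_add_mass a t b]]
    linarith
  have hsplit (t) : ∫ s in a..t, ρ s * ((q t - q s) * k (mass ρ s t))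
      = q t * (∫ s in a..t, ρ s * k (mass ρ s t)) - ∫ s in a..t, ρ s * (q s * k (mass ρ s t)) := by
    rw [← intervalIntegral.integral_const_mul, ← intervalIntegral.integral_sub]
    · exact intervalIntegral.integral_congr fun s _ => by ring
    · exact (h.intervalIntegrable_mul (by fun_prop) a t).const_mul _
    · exact h.intervalIntegrable_mul (by fun_prop) a t
  simp_rw [triangleIntegral, hsplit, mul_sub]
  rw [intervalIntegral.integral_sub, hswap, sub_eq_zero]
  · exact intervalIntegral.integral_congr fun t _ => by rw [hinner, mul_assoc]
  · exact h.intervalIntegrable_mul (hq.mul (h.continuous_integral_mul hkm a)) a b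
  · exact h.intervalIntegrable_mul
      (h.continuous_integral_mul (g := fun s t => q s * k (mass ρ s t)) (by fun_prop) a) a b

lemma triangleIntegral_sinChord (h : IsUnitDensity ρ) (hab : a ≤ b) :
    triangleIntegral ρ a b (fun s t => sinChord (mass ρ a b) (mass ρ s t) (t - s - mass ρ s t))
      = mass ρ a b - sin (mass ρ a b) := by
  have hm := h.continuous_mass
  set l := mass ρ a b
  have hdecomp : (fun s t => sinChord l (mass ρ s t) (t - s - mass ρ s t)) = fun s t =>
      sin (mass ρ s t) + ((t - mass ρ a t) - (s - mass ρ a s))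
        * ((sin (l - mass ρ s t) - sin (mass ρ s t)) / (π - l)) := by
    ext s t
    rw [sinChord, ← h.mass_add_mass a s t]
    ring
  rw [hdecomp, h.triangleIntegral_add (by fun_prop) (by fun_prop), h.triangleIntegral_sin_mass,
    h.triangleIntegral_sub_mul_eq_zero (q := fun t => t - mass ρ a t)
      (k := fun x => (sin (l - x) - sin x) / (π - l)) hab (by fun_prop) (by fun_prop)
      fun x => by rw [sub_sub_cancel]; ring, add_zero]

end IsUnitDensity

/-- The amount by which the chord `sinChord` lies below the sine at the pair `s`, `t`, for the
density `ρ` on `[a, a + π]`. -/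
noncomputable def sinChordDefect (ρ : ℝ → ℝ) (a s t : ℝ) : ℝ :=
  sin (t - s) - sinChord (mass ρ a (a + π)) (mass ρ s t) (t - s - mass ρ s t)

namespace IsUnitDensity

variable {ρ : ℝ → ℝ} {a s t : ℝ}

lemma continuous_sinChordDefect (h : IsUnitDensity ρ) (a : ℝ) :
    Continuous fun z : ℝ × ℝ => sinChordDefect ρ a z.1 z.2 := by
  have := h.continuous_mass
  unfold sinChordDefect sinChord
  fun_prop

lemma sinChordDefect_nonneg (h : IsUnitDensity ρ) (has : a ≤ s) (hst : s ≤ t) (hta : t ≤ a + π) :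
    0 ≤ sinChordDefect ρ a s t := by
  have hsum := h.mass_add_mass a s t
  have hsum' := h.mass_add_mass a t (a + π)
  have := sinChord_le_sin (l := mass ρ a (a + π)) (u := mass ρ s t) (v := t - s - mass ρ s t)
    (h.mass_nonneg hst) (by linarith [h.mass_nonneg has, h.mass_nonneg hta])
    (by linarith [h.mass_le_sub hst]) (by linarith [h.mass_le_sub has, h.mass_le_sub hta])
  rw [add_sub_cancel] at this
  exact sub_nonneg.2 this

lemma eq_mass_or_of_sinChordDefect_eq_zero (h : IsUnitDensity ρ) (has : a ≤ s) (hst : s ≤ t)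
    (hta : t ≤ a + π) (h0 : sinChordDefect ρ a s t = 0) :
    t - s - mass ρ s t = 0 ∨ t - s - mass ρ s t = π - mass ρ a (a + π) := by
  have hsum := h.mass_add_mass a s t
  have hsum' := h.mass_add_mass a t (a + π)
  by_contra! hne
  have hpos := (sub_nonneg.2 (h.mass_le_sub hst)).lt_of_ne' hne.1
  have hlt : t - s - mass ρ s t < π - mass ρ a (a + π) :=
    lt_of_le_of_ne (by linarith [h.mass_le_sub has, h.mass_le_sub hta]) hne.2
  have := sinChord_lt_sin (h.mass_nonneg hst) (by linarith [h.mass_nonneg has, h.mass_nonneg hta])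
    hpos hlt
  rw [add_sub_cancel] at this
  exact (sub_pos.2 this).ne' h0

lemma triangleIntegral_sin_sub (h : IsUnitDensity ρ) (a : ℝ) :
    triangleIntegral ρ a (a + π) (fun s t => sin (t - s))
      = mass ρ a (a + π) - sin (mass ρ a (a + π))
        + triangleIntegral ρ a (a + π) (sinChordDefect ρ a) := by
  have := h.continuous_mass
  rw [← h.triangleIntegral_sinChord (by linarith [pi_pos]),
    ← h.triangleIntegral_add (by unfold sinChord; fun_prop) (h.continuous_sinChordDefect a)]
  simp only [sinChordDefect, add_sub_cancel]

theorem mass_sub_sin_mass_le (h : IsUnitDensity ρ) (a : ℝ) :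
    mass ρ a (a + π) - sin (mass ρ a (a + π))
      ≤ triangleIntegral ρ a (a + π) (fun s t => sin (t - s)) := by
  rw [h.triangleIntegral_sin_sub, le_add_iff_nonneg_right]
  exact h.triangleIntegral_nonneg (by linarith [pi_pos]) fun s t => h.sinChordDefect_nonneg

end IsUnitDensity

/-- The density `ρ` on `[a, b]` is the indicator of an interval `[c, d]`. Equality almost everywhere
is encoded by masses. -/
def HasCentralArc (ρ : ℝ → ℝ) (a b : ℝ) : Prop :=
  ∃ c d, a ≤ c ∧ c ≤ d ∧ d ≤ b ∧ mass ρ a c = 0 ∧ mass ρ c d = d - c ∧ mass ρ d b = 0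

/-- The density `ρ` on `[a, b]` is the indicator of the complement of an interval `[c, d]`. Equality
almost everywhere is encoded by masses. -/
def HasCentralGap (ρ : ℝ → ℝ) (a b : ℝ) : Prop :=
  ∃ c d, a ≤ c ∧ c ≤ d ∧ d ≤ b ∧ mass ρ a c = c - a ∧ mass ρ c d = 0 ∧ mass ρ d b = b - d

/-- The measure with density `ρ` on `(a, b]`; its support is where equality in the sine inequality
can be tested pointwise. -/
noncomputable def densityMeasure (ρ : ℝ → ℝ) (a b : ℝ) : Measure ℝ :=
  (volume.restrict (Ioc a b)).withDensity fun t => ENNReal.ofReal (ρ t)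

namespace IsUnitDensity

variable {ρ : ℝ → ℝ} {a b c d s t : ℝ}

lemma support_densityMeasure_subset (ρ : ℝ → ℝ) (a b : ℝ) :
    (densityMeasure ρ a b).support ⊆ Icc a b :=
  Measure.support_subset_of_isClosed isClosed_Icc <|
    (withDensity_absolutelyContinuous _ _).ae_le <|
      (ae_restrict_mem measurableSet_Ioc).mono Ioc_subset_Icc_self

lemma ae_densityMeasure_iff (h : IsUnitDensity ρ) {p : ℝ → Prop} :
    (∀ᵐ t ∂densityMeasure ρ a b, p t) ↔ ∀ᵐ t ∂volume.restrict (Ioc a b), ρ t ≠ 0 → p t := by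
  rw [densityMeasure, ae_withDensity_iff h.measurable.ennreal_ofReal]
  simp only [ne_eq, ENNReal.ofReal_eq_zero, (h.nonneg _).ge_iff_eq']

lemma mass_eq_zero_of_disjoint (h : IsUnitDensity ρ) (hac : a ≤ c) (hdb : d ≤ b) (hcd : c ≤ d)
    (hdisj : Disjoint (Ioo c d) (densityMeasure ρ a b).support) : mass ρ c d = 0 := by
  have hae : ∀ᵐ t ∂volume.restrict (Ioc a b), ρ t ≠ 0 → t ∈ (densityMeasure ρ a b).support :=
    h.ae_densityMeasure_iff.1 Measure.support_mem_ae
  rw [mass, intervalIntegral.integral_of_le hcd, integral_Ioc_eq_integral_Ioo]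
  refine integral_eq_zero_of_ae ?_
  filter_upwards [ae_restrict_of_ae_restrict_of_subset
    (Ioo_subset_Ioc_self.trans (Ioc_subset_Ioc hac hdb)) hae, ae_restrict_mem measurableSet_Ioo]
    with t ht htcd
  by_contra hne
  exact hdisj.notMem_of_mem_left htcd (ht hne)

lemma ae_eq_zero_of_integral_mul_eq_zero (h : IsUnitDensity ρ) {f : ℝ → ℝ} (hf : Continuous f)
    (hab : a ≤ b) (hf0 : ∀ t ∈ Icc a b, 0 ≤ f t) (hint : ∫ t in a..b, ρ t * f t = 0) :
    ∀ᵐ t ∂densityMeasure ρ a b, f t = 0 := by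
  rw [h.ae_densityMeasure_iff]
  rw [intervalIntegral.integral_eq_zero_iff_of_le_of_nonneg_ae hab ?_
    (h.intervalIntegrable_mul hf a b)] at hint
  · filter_upwards [hint] with t ht hρ using (mul_eq_zero.1 ht).resolve_left hρ
  · filter_upwards [ae_restrict_mem measurableSet_Ioc] with t ht
      using mul_nonneg (h.nonneg t) (hf0 t (Ioc_subset_Icc_self ht))

lemma eq_zero_of_triangleIntegral_eq_zero (h : IsUnitDensity ρ) {g : ℝ → ℝ → ℝ}
    (hg : Continuous fun z : ℝ × ℝ => g z.1 z.2)
    (hg0 : ∀ s t, a ≤ s → s ≤ t → t ≤ b → 0 ≤ g s t) (hint : triangleIntegral ρ a b g = 0)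
    (hs : s ∈ (densityMeasure ρ a b).support) (ht : t ∈ (densityMeasure ρ a b).support)
    (hst : s < t) : g s t = 0 := by
  have hab := (support_densityMeasure_subset ρ a b hs).1.trans
    (support_densityMeasure_subset ρ a b hs).2
  by_contra hne
  obtain ⟨U, hU, V, hV, hUV⟩ := mem_nhds_prod_iff.1 <|
    (hg.continuousAt.eventually_ne hne).and
      (continuous_fst.continuousAt.eventually_lt continuous_snd.continuousAt hst)
  have houter := h.ae_eq_zero_of_integral_mul_eq_zero (h.continuous_integral_mul hg a) hab
    (fun t ht => h.integral_mul_nonneg ht.1 fun s hs => hg0 s t hs.1 hs.2 ht.2) hint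
  obtain ⟨t', htV, htab, ht'⟩ : ∃ t' ∈ V, t' ∈ Ioc a b ∧ ∫ s in a..t', ρ s * g s t' = 0 := by
    have hmem : ∀ᵐ t ∂densityMeasure ρ a b, t ∈ Ioc a b :=
      (withDensity_absolutelyContinuous _ _).ae_le (ae_restrict_mem measurableSet_Ioc)
    have hfreq : ∃ᵐ t ∂densityMeasure ρ a b, t ∈ V :=
      frequently_ae_mem_iff.2 (Measure.mem_support_iff_forall t |>.1 ht V hV).ne'
    exact (hfreq.and_eventually (hmem.and houter)).exists
  have hinner := h.ae_densityMeasure_iff.1 <| h.ae_eq_zero_of_integral_mul_eq_zero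
    (f := fun s => g s t') (by fun_prop) htab.1.le (fun s hs => hg0 s t' hs.1 hs.2 htab.2) ht'
  have hUnull : ∀ᵐ s ∂densityMeasure ρ a b, s ∉ U := by
    rw [h.ae_densityMeasure_iff]
    rw [ae_restrict_iff' measurableSet_Ioc] at hinner ⊢
    filter_upwards [hinner] with s hs hsab hρ hsU
    have hsV := hUV (mk_mem_prod hsU htV)
    exact hsV.1 (hs ⟨hsab.1, hsV.2.le⟩ hρ)
  exact (Measure.mem_support_iff_forall s |>.1 hs U hU).ne'
    (measure_eq_zero_iff_ae_notMem.2 hUnull)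

lemma exists_support_bounds (h : IsUnitDensity ρ) (hab : a ≤ b) (hpos : 0 < mass ρ a b) :
    ∃ c ∈ (densityMeasure ρ a b).support, ∃ d ∈ (densityMeasure ρ a b).support,
      c ≤ d ∧ mass ρ a c = 0 ∧ mass ρ d b = 0 := by
  set S := (densityMeasure ρ a b).support with hS
  have hSsub : S ⊆ Icc a b := support_densityMeasure_subset ρ a b
  have hSc : IsCompact S := isCompact_Icc.of_isClosed_subset Measure.isClosed_support hSsub
  have hSne : S.Nonempty := by
    by_contra! hempty
    exact hpos.ne' (h.mass_eq_zero_of_disjoint le_rfl le_rfl hab (by simp [← hS, hempty]))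
  obtain ⟨c, hcS, hc⟩ := hSc.exists_isLeast hSne
  obtain ⟨d, hdS, hd⟩ := hSc.exists_isGreatest hSne
  exact ⟨c, hcS, d, hdS, hd hcS,
    h.mass_eq_zero_of_disjoint le_rfl (hSsub hcS).2 (hSsub hcS).1 <|
      disjoint_left.2 fun t ht htS => ht.2.not_ge (hc htS),
    h.mass_eq_zero_of_disjoint (hSsub hdS).1 le_rfl (hSsub hdS).2 <|
      disjoint_left.2 fun t ht htS => ht.1.not_ge (hd htS)⟩

lemma hasCentralGap_of_jump (h : IsUnitDensity ρ) {M : ℝ} (hM : 0 < M)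
    (hjump : ∀ t ∈ (densityMeasure ρ a b).support, mass ρ a t = t - a ∨ mass ρ a t = t - a - M)
    (ha : a ∈ (densityMeasure ρ a b).support) (hb : b ∈ (densityMeasure ρ a b).support)
    (hbM : mass ρ a b = b - a - M) : HasCentralGap ρ a b := by
  set S := (densityMeasure ρ a b).support
  have hSsub : S ⊆ Icc a b := support_densityMeasure_subset ρ a b
  have hSc : IsCompact S := isCompact_Icc.of_isClosed_subset Measure.isClosed_support hSsub
  have hcont : Continuous (mass ρ a) := (h.lipschitzWith_mass a).continuous
  obtain ⟨c, ⟨hcS, hc0 : mass ρ a c = c - a⟩, hc⟩ :=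
    (hSc.inter_right (isClosed_eq hcont (continuous_sub_right a))).exists_isGreatest
      ⟨a, ha, by simp⟩
  obtain ⟨d, ⟨hdS, hdM : mass ρ a d = d - a - M⟩, hd⟩ :=
    (hSc.inter_right (isClosed_eq hcont (g := fun t => t - a - M) (by fun_prop))).exists_isLeast
      ⟨b, hb, hbM⟩
  have hcd : c ≤ d := by
    by_contra! hlt
    linarith [h.mass_le_sub hlt.le, h.mass_add_mass a d c]
  refine ⟨c, d, (hSsub hcS).1, hcd, (hSsub hdS).2, hc0, ?_, by linarith [h.mass_add_mass a d b]⟩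
  refine h.mass_eq_zero_of_disjoint (hSsub hcS).1 (hSsub hdS).2 hcd
    (disjoint_left.2 fun t ht htS => ?_)
  rcases hjump t htS with ht0 | htM
  · exact ht.1.not_ge (hc ⟨htS, ht0⟩)
  · exact ht.2.not_ge (hd ⟨htS, htM⟩)

/-- On the support of the density the complementary mass `t - s - mass ρ s t` of an interval is
either zero or everything, so it jumps at most once there. -/
theorem hasCentralArc_or_hasCentralGap_of_eq (h : IsUnitDensity ρ)
    (heq : triangleIntegral ρ a (a + π) (fun s t => sin (t - s))
      = mass ρ a (a + π) - sin (mass ρ a (a + π))) (hpos : 0 < mass ρ a (a + π)) :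
    HasCentralArc ρ a (a + π) ∨ HasCentralGap ρ a (a + π) := by
  have hSsub := support_densityMeasure_subset ρ a (a + π)
  obtain ⟨c, hcS, d, hdS, hcd, hac, hdb⟩ :=
    h.exists_support_bounds (by linarith [pi_pos]) hpos
  have hadd := h.mass_add_mass
  have hdich {t} (ht : t ∈ (densityMeasure ρ a (a + π)).support) (hct : c ≤ t) :
      t - c - mass ρ c t = 0 ∨ t - c - mass ρ c t = π - mass ρ a (a + π) := by
    rcases hct.eq_or_lt with rfl | hct
    · simp
    refine h.eq_mass_or_of_sinChordDefect_eq_zero (hSsub hcS).1 hct.le (hSsub ht).2 <|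
      h.eq_zero_of_triangleIntegral_eq_zero (h.continuous_sinChordDefect a)
        (fun s t => h.sinChordDefect_nonneg) ?_ hcS ht hct
    linarith [h.triangleIntegral_sin_sub a]
  by_cases hfull : d - c - mass ρ c d = 0
  · exact .inl ⟨c, d, (hSsub hcS).1, hcd, (hSsub hdS).2, hac, by linarith, hdb⟩
  have hM := (hdich hdS hcd).resolve_left hfull
  obtain rfl : c = a := by linarith [hadd a c d, hadd a d (a + π), (hSsub hcS).1, (hSsub hdS).2]
  obtain rfl : d = c + π := by linarith [hadd c d (c + π), (hSsub hdS).2]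
  have hMpos : 0 < π - mass ρ c (c + π) := by
    have := h.mass_le_sub hcd
    exact lt_of_le_of_ne (by linarith) fun h0 => hfull (by linarith)
  refine .inr <| h.hasCentralGap_of_jump hMpos (fun t ht => ?_) hcS hdS (by linarith)
  exact (hdich ht (hSsub ht).1).imp (fun _ => by linarith) fun _ => by linarith

end IsUnitDensity

section Plane

/-- The Euclidean plane. -/
abbrev Plane := EuclideanSpace ℝ (Fin 2)

/-- The unit vector with polar angle `θ`; all directions, in particular outer normals, are given
by such angles. -/
noncomputable def dir (θ : ℝ) : Plane := !₂[cos θ, sin θ]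

@[simp] lemma dir_apply_zero (θ : ℝ) : dir θ 0 = cos θ := rfl

@[simp] lemma dir_apply_one (θ : ℝ) : dir θ 1 = sin θ := rfl

lemma inner_dir (θ : ℝ) (p : Plane) : ⟪dir θ, p⟫_ℝ = cos θ * p 0 + sin θ * p 1 := by
  simp [PiLp.inner_apply, Fin.sum_univ_two, mul_comm]

lemma inner_dir_dir (φ θ : ℝ) : ⟪dir φ, dir θ⟫_ℝ = cos (φ - θ) := by
  simp [inner_dir, cos_sub]

@[simp] lemma norm_dir (θ : ℝ) : ‖dir θ‖ = 1 := by
  rw [← pow_left_inj₀ (norm_nonneg _) zero_le_one two_ne_zero, ← real_inner_self_eq_norm_sq]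
  rw [inner_dir_dir, sub_self, cos_zero, one_pow]

lemma hasDerivAt_dir (θ : ℝ) : HasDerivAt dir (dir (θ + π / 2)) θ := by
  have hcoord : HasDerivAt (fun θ => ![cos θ, sin θ]) ![-sin θ, cos θ] θ := hasDerivAt_pi.2 fun i =>
    by fin_cases i <;> simp [hasDerivAt_cos, hasDerivAt_sin]
  refine ((PiLp.hasFDerivAt_toLp 2 _).comp_hasDerivAt θ hcoord).congr_deriv ?_
  simp [dir, cos_add_pi_div_two, sin_add_pi_div_two]

@[fun_prop] lemma continuous_dir : Continuous dir :=
  continuous_iff_continuousAt.2 fun θ => (hasDerivAt_dir θ).continuousAt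

lemma lipschitzWith_dir : LipschitzWith 1 dir :=
  lipschitzWith_of_nnnorm_deriv_le (fun θ => (hasDerivAt_dir θ).differentiableAt) fun θ => by
    rw [(hasDerivAt_dir θ).deriv, ← NNReal.coe_le_coe]
    simp

lemma dir_periodic : Function.Periodic dir (2 * π) := fun θ => by simp [dir]

@[simp] lemma dir_add_pi (θ : ℝ) : dir (θ + π) = -dir θ := by
  ext i
  fin_cases i <;> simp

lemma inner_dir_mul_sin_sub (p : Plane) (a b φ : ℝ) :
    ⟪dir φ, p⟫_ℝ * sin (b - a) = ⟪dir a, p⟫_ℝ * sin (b - φ) + ⟪dir b, p⟫_ℝ * sin (φ - a) := by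
  simp only [inner_dir, sin_sub]
  ring

lemma inner_eq_inner_dir_mul_add (a : ℝ) (p q : Plane) : ⟪p, q⟫_ℝ = ⟪dir a, p⟫_ℝ * ⟪dir a, q⟫_ℝ
    + ⟪dir (a + π / 2), p⟫_ℝ * ⟪dir (a + π / 2), q⟫_ℝ := by
  rw [inner_dir, inner_dir, inner_dir, inner_dir, cos_add_pi_div_two, sin_add_pi_div_two]
  simp only [PiLp.inner_apply, Fin.sum_univ_two, RCLike.inner_apply, conj_trivial]
  linear_combination -(p 0 * q 0 + p 1 * q 1) * sin_sq_add_cos_sq a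

lemma inner_dir_eq_cos_mul_add (a b : ℝ) (p : Plane) :
    ⟪dir b, p⟫_ℝ = cos (b - a) * ⟪dir a, p⟫_ℝ + sin (b - a) * ⟪dir (a + π / 2), p⟫_ℝ := by
  rw [inner_eq_inner_dir_mul_add a, inner_dir_dir, inner_dir_dir, ← cos_neg (a - b),
    ← cos_neg (a + π / 2 - b), neg_sub, neg_sub, ← sub_sub, cos_sub_pi_div_two]

lemma eq_inner_dir_smul_add (a : ℝ) (p : Plane) :
    p = ⟪dir a, p⟫_ℝ • dir a + ⟪dir (a + π / 2), p⟫_ℝ • dir (a + π / 2) := by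
  refine ext_inner_left ℝ fun v => ?_
  rw [inner_eq_inner_dir_mul_add a v p]
  simp only [inner_add_right, inner_smul_right, real_inner_comm v]
  ring

lemma exists_eq_norm_smul_dir (p : Plane) : ∃ θ, p = ‖p‖ • dir θ := by
  have hnorm : ‖p‖ = ‖(⟨p 0, p 1⟩ : ℂ)‖ := by
    rw [EuclideanSpace.norm_eq, Complex.norm_eq_sqrt_sq_add_sq]
    simp [Fin.sum_univ_two]
  refine ⟨Complex.arg ⟨p 0, p 1⟩, ?_⟩
  ext i
  fin_cases i
  · simp [hnorm]
  · simp [hnorm]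

lemma exists_eq_mul_inner_dir (f : Plane →L[ℝ] ℝ) : ∃ c ≥ 0, ∃ θ, ∀ p, f p = c * ⟪dir θ, p⟫_ℝ := by
  set v := (InnerProductSpace.toDual ℝ Plane).symm f
  obtain ⟨θ, hθ⟩ := exists_eq_norm_smul_dir v
  refine ⟨‖v‖, norm_nonneg v, θ, fun p => ?_⟩
  rw [← InnerProductSpace.toDual_symm_apply (𝕜 := ℝ) (x := p) (y := f), ← real_inner_smul_left,
    ← hθ]

lemma inner_dir_le_of_mem_Icc {p q : Plane} {a b φ : ℝ} (ha : ⟪dir a, q⟫_ℝ ≤ ⟪dir a, p⟫_ℝ)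
    (hb : ⟪dir b, q⟫_ℝ ≤ ⟪dir b, p⟫_ℝ) (hφ : φ ∈ Icc a b) (hab : b - a < π) :
    ⟪dir φ, q⟫_ℝ ≤ ⟪dir φ, p⟫_ℝ := by
  rcases (hφ.1.trans hφ.2).eq_or_lt with rfl | hlt
  · obtain rfl := le_antisymm hφ.1 hφ.2
    exact ha
  have hb0 : 0 ≤ sin (b - φ) := sin_nonneg_of_nonneg_of_le_pi (by grind) (by grind)
  have ha0 : 0 ≤ sin (φ - a) := sin_nonneg_of_nonneg_of_le_pi (by grind) (by grind)
  refine le_of_mul_le_mul_right ?_ (sin_pos_of_pos_of_lt_pi (sub_pos.2 hlt) hab)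
  rw [inner_dir_mul_sin_sub q, inner_dir_mul_sin_sub p]
  exact add_le_add (mul_le_mul_of_nonneg_right ha hb0) (mul_le_mul_of_nonneg_right hb ha0)

lemma inner_dir_le_norm (θ : ℝ) (p : Plane) : ⟪dir θ, p⟫_ℝ ≤ ‖p‖ := by
  simpa using real_inner_le_norm (dir θ) p

lemma inner_dir_le_of_mem_closedBall {p c : Plane} {r : ℝ} (h : p ∈ closedBall c r) (θ : ℝ) :
    ⟪dir θ, p⟫_ℝ ≤ ⟪dir θ, c⟫_ℝ + r := by
  have := inner_dir_le_norm θ (p - c)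
  rw [inner_sub_right] at this
  linarith [mem_closedBall_iff_norm.1 h]

lemma eq_add_smul_dir_of_le_inner {p c : Plane} {r θ : ℝ} (h : p ∈ closedBall c r)
    (hp : ⟪dir θ, c⟫_ℝ + r ≤ ⟪dir θ, p⟫_ℝ) : p = c + r • dir θ := by
  rw [mem_closedBall_iff_norm] at h
  have hr : 0 ≤ r := (norm_nonneg _).trans h
  have hsq : ‖(p - c) - r • dir θ‖ ^ 2 ≤ 0 := by
    rw [norm_sub_sq_real, real_inner_smul_right, real_inner_comm, norm_smul, norm_dir, mul_one,
      Real.norm_of_nonneg hr, inner_sub_right]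
    nlinarith [norm_nonneg (p - c)]
  rw [← sub_eq_zero, ← norm_eq_zero, ← sub_sub]
  exact pow_eq_zero_iff two_ne_zero |>.1 (hsq.antisymm (sq_nonneg _))

end Plane

section SupportPoints

/-- `p` is a point of `K` at which the outer normal direction `θ` is attained. -/
def IsSupportPt (K : Set Plane) (θ : ℝ) (p : Plane) : Prop :=
  p ∈ K ∧ ∀ q ∈ K, ⟪dir θ, q⟫_ℝ ≤ ⟪dir θ, p⟫_ℝ

variable {lam θ a b : ℝ} {K : Set Plane} {p q : Plane}

namespace IsSupportPt

lemma notMem_interior (h : IsSupportPt K θ p) : p ∉ interior K := fun hp => by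
  have hmax : IsLocalMax (innerSL ℝ (dir θ)) p :=
    IsMaxOn.isLocalMax (s := K) (fun q hq => h.2 q hq) (mem_interior_iff_mem_nhds.1 hp)
  have hzero := hmax.fderiv_eq_zero
  rw [ContinuousLinearMap.fderiv] at hzero
  simpa using congr($hzero (dir θ))

lemma mem_frontier (h : IsSupportPt K θ p) : p ∈ frontier K :=
  ⟨subset_closure h.1, h.notMem_interior⟩

lemma of_inner_le (h : IsSupportPt K θ p) (hq : q ∈ K) (hpq : ⟪dir θ, p⟫_ℝ ≤ ⟪dir θ, q⟫_ℝ) :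
    IsSupportPt K θ q :=
  ⟨hq, fun z hz => (h.2 z hz).trans hpq⟩

lemma of_mem_Icc {φ : ℝ} (ha : IsSupportPt K a p) (hb : IsSupportPt K b p) (hφ : φ ∈ Icc a b)
    (hab : b - a < π) : IsSupportPt K φ p :=
  ⟨ha.1, fun q hq => inner_dir_le_of_mem_Icc (ha.2 q hq) (hb.2 q hq) hφ hab⟩

end IsSupportPt

lemma not_isSupportPt_add_pi (hK : IsPlanarConvexBody K) (h : IsSupportPt K θ p) :
    ¬IsSupportPt K (θ + π) p := fun hπ => by
  obtain ⟨z, hz⟩ := hK.interior_nonempty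
  have hle := hπ.2 z (interior_subset hz)
  rw [dir_add_pi, inner_neg_left, inner_neg_left, neg_le_neg_iff] at hle
  exact (h.of_inner_le (interior_subset hz) hle).notMem_interior hz

lemma exists_isSupportPt (hK : IsPlanarConvexBody K) (θ : ℝ) : ∃ p, IsSupportPt K θ p :=
  hK.isCompact.exists_isMaxOn (hK.interior_nonempty.mono interior_subset)
    (innerSL ℝ (dir θ)).continuous.continuousOn

lemma exists_isSupportPt_of_mem_frontier (hK : IsPlanarConvexBody K) (hp : p ∈ frontier K) :
    ∃ θ, IsSupportPt K θ p := by
  obtain ⟨f, hf⟩ := geometric_hahn_banach_open_point hK.convex.interior isOpen_interior hp.2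
  obtain ⟨c, hc, θ, hθ⟩ := exists_eq_mul_inner_dir f
  have hc0 : c ≠ 0 := by
    rintro rfl
    obtain ⟨z, hz⟩ := hK.interior_nonempty
    simpa [hθ] using hf z hz
  refine ⟨θ, hK.isCompact.isClosed.closure_eq ▸ hp.1, fun q hq => ?_⟩
  have hqi : q ∈ closure (interior K) := by
    rw [hK.convex.closure_interior_eq_closure_of_nonempty_interior hK.interior_nonempty]
    exact subset_closure hq
  have hle : f q ≤ f p := closure_minimal (fun z hz => (hf z hz).le)
    (isClosed_le f.continuous continuous_const) hqi
  rw [hθ, hθ] at hle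
  exact le_of_mul_le_mul_left hle (hc.lt_of_ne' hc0)

lemma IsSupportPt.eq (hK : IsLamConvexBody lam K) (hp : IsSupportPt K θ p)
    (hq : IsSupportPt K θ q) : p = q := by
  by_contra hne
  set f : ℝ → Plane := fun t => AffineMap.lineMap (k := ℝ) p q t
  have hf : Continuous f := AffineMap.lineMap_continuous
  have hface {t : ℝ} (h0 : 0 ≤ t) (h1 : t ≤ 1) : f t ∈ frontier K := by
    have hpq : ⟪dir θ, p⟫_ℝ = ⟪dir θ, q⟫_ℝ := le_antisymm (hq.2 p hp.1) (hp.2 q hq.1)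
    refine (hp.of_inner_le (hK.convex.lineMap_mem hp.1 hq.1 ⟨h0, h1⟩) (le_of_eq ?_)).mem_frontier
    rw [AffineMap.lineMap_apply_module, inner_add_right, inner_smul_right, inner_smul_right, hpq]
    ring
  obtain ⟨U, hU, c, hc, hUc⟩ := hK.barrier (f (1 / 2)) (hface (by norm_num) (by norm_num))
  have hnear : ∀ᶠ s in 𝓝[>] (0 : ℝ), f (1 / 2 - s) ∈ U ∧ f (1 / 2 + s) ∈ U ∧ s < 1 / 2 := by
    refine nhdsWithin_le_nhds (inter_mem ?_ (inter_mem ?_ (gt_mem_nhds one_half_pos)))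
    · exact (hf.comp (by fun_prop : Continuous fun s : ℝ => 1 / 2 - s)).continuousAt.eventually_mem
        (by simpa using hU)
    · exact (hf.comp (by fun_prop : Continuous fun s : ℝ => 1 / 2 + s)).continuousAt.eventually_mem
        (by simpa using hU)
  obtain ⟨s, ⟨hs₁, hs₂, hs⟩, hs0 : 0 < s⟩ := (hnear.and self_mem_nhdsWithin).exists
  have hball := strictConvex_closedBall ℝ c (1 / lam)
    (hUc ⟨hs₁, hface (by linarith) (by linarith)⟩) (hUc ⟨hs₂, hface (by linarith) (by linarith)⟩)
    ((AffineMap.lineMap_injective ℝ hne).ne (by linarith)) one_half_pos one_half_pos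
    (by norm_num)
  have hmid : (1 / 2 : ℝ) • f (1 / 2 - s) + (1 / 2 : ℝ) • f (1 / 2 + s) = f (1 / 2) := by
    simp only [f, AffineMap.lineMap_apply_module]
    module
  rw [hmid, interior_closedBall' c] at hball
  exact (mem_ball.1 hball).ne (mem_sphere.1 hc)

/-- A support point of `K` in the direction `θ`; for a `lam`-convex body it is the only one. -/
noncomputable def supportPt (K : Set Plane) (θ : ℝ) : Plane :=
  Classical.epsilon (IsSupportPt K θ)

lemma isSupportPt_supportPt (hK : IsPlanarConvexBody K) (θ : ℝ) :
    IsSupportPt K θ (supportPt K θ) :=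
  Classical.epsilon_spec (exists_isSupportPt hK θ)

lemma IsSupportPt.eq_supportPt (hK : IsLamConvexBody lam K) (hp : IsSupportPt K θ p) :
    p = supportPt K θ :=
  hp.eq hK (isSupportPt_supportPt hK.toIsPlanarConvexBody θ)

lemma supportPt_congr (h : dir a = dir b) : supportPt K a = supportPt K b := by
  unfold supportPt IsSupportPt
  rw [h]

lemma supportPt_periodic (K : Set Plane) : Function.Periodic (supportPt K) (2 * π) := fun θ =>
  supportPt_congr (dir_periodic θ)

lemma continuous_supportPt (hK : IsLamConvexBody lam K) : Continuous (supportPt K) := by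
  have hspec := isSupportPt_supportPt hK.toIsPlanarConvexBody
  rw [continuous_iff_continuousAt]
  intro θ
  refine hK.isCompact.tendsto_nhds_of_unique_mapClusterPt (.of_forall fun φ => (hspec φ).1) ?_
  intro p hp hcluster
  suffices IsSupportPt K θ p from this.eq_supportPt hK
  refine ⟨hp, fun q hq => ?_⟩
  by_contra! hlt
  have hev : ∀ᶠ z : Plane × ℝ in 𝓝 p ×ˢ 𝓝 θ, ⟪dir z.2, z.1⟫_ℝ < ⟪dir z.2, q⟫_ℝ := by
    rw [← nhds_prod_eq]
    exact ContinuousAt.eventually_lt (by fun_prop) (by fun_prop) hlt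
  obtain ⟨U, hU, V, hV, hUV⟩ := eventually_prod_iff.1 hev
  obtain ⟨φ, hφU, hφV⟩ := ((mapClusterPt_iff_frequently.1 hcluster _ hU).and_eventually hV).exists
  exact (hUV hφU hφV).not_ge ((hspec φ).2 q hq)

/-- The support function of `K` at the direction `θ`. -/
noncomputable def supportFn (K : Set Plane) (θ : ℝ) : ℝ := ⟪dir θ, supportPt K θ⟫_ℝ

lemma continuous_supportFn (hK : IsLamConvexBody lam K) : Continuous (supportFn K) := by
  have := continuous_supportPt hK
  unfold supportFn
  fun_prop

lemma inner_dir_le_supportFn (hK : IsPlanarConvexBody K) (hp : p ∈ K) (θ : ℝ) :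
    ⟪dir θ, p⟫_ℝ ≤ supportFn K θ :=
  (isSupportPt_supportPt hK θ).2 p hp

lemma mem_of_forall_inner_dir_le (hK : IsPlanarConvexBody K)
    (hp : ∀ θ, ⟪dir θ, p⟫_ℝ ≤ supportFn K θ) : p ∈ K := by
  by_contra hpK
  obtain ⟨f, u, hf, hu⟩ := geometric_hahn_banach_closed_point hK.convex hK.isCompact.isClosed hpK
  obtain ⟨c, hc, θ, hθ⟩ := exists_eq_mul_inner_dir f
  have := (hf _ (isSupportPt_supportPt hK θ).1).trans hu
  rw [hθ, hθ] at this
  exact this.not_ge (mul_le_mul_of_nonneg_left (hp θ) hc)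

lemma supportFn_sub_inner_le (hK : IsPlanarConvexBody K) (φ θ : ℝ) :
    supportFn K φ - ⟪dir φ, supportPt K θ⟫_ℝ
      ≤ ‖supportPt K φ - supportPt K θ‖ * ‖φ - θ‖ := by
  have hmax := inner_dir_le_supportFn hK (isSupportPt_supportPt hK φ).1 θ
  have hcs := real_inner_le_norm (dir φ - dir θ) (supportPt K φ - supportPt K θ)
  have hlip := mul_le_mul_of_nonneg_right (lipschitzWith_dir.dist_le_mul φ θ)
    (norm_nonneg (supportPt K φ - supportPt K θ))
  simp only [inner_sub_left, inner_sub_right] at hcs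
  rw [dist_eq_norm, dist_eq_norm, NNReal.coe_one, one_mul] at hlip
  unfold supportFn at *
  linarith

lemma hasDerivAt_supportFn (hK : IsLamConvexBody lam K) (θ : ℝ) :
    HasDerivAt (supportFn K) ⟪dir (θ + π / 2), supportPt K θ⟫_ℝ θ := by
  have hb := hK.toIsPlanarConvexBody
  have hdiff : HasDerivAt (fun φ => supportFn K φ - ⟪dir φ, supportPt K θ⟫_ℝ) 0 θ := by
    have hcont : Tendsto (fun φ => ‖supportPt K φ - supportPt K θ‖) (𝓝 θ) (𝓝 0) :=
      tendsto_iff_norm_sub_tendsto_zero.1 ((continuous_supportPt hK).tendsto θ)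
    have hlittle := ((Asymptotics.isLittleO_one_iff ℝ).2 hcont).mul_isBigO
      (Asymptotics.isBigO_refl (fun φ : ℝ => φ - θ) (𝓝 θ)).norm_left
    simp only [one_mul] at hlittle
    rw [hasDerivAt_iff_isLittleO]
    refine (Asymptotics.IsBigO.of_norm_le fun φ => ?_).trans_isLittleO hlittle
    have hnonneg := sub_nonneg.2 (inner_dir_le_supportFn hb (isSupportPt_supportPt hb θ).1 φ)
    rw [← supportFn, sub_self, sub_zero, smul_zero, sub_zero]
    exact (Real.norm_of_nonneg hnonneg).trans_le (supportFn_sub_inner_le hb φ θ)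
  have hadd := hdiff.add ((hasDerivAt_dir θ).inner ℝ (hasDerivAt_const θ (supportPt K θ)))
  simpa [Pi.add_def] using hadd

end SupportPoints

section Barrier

lemma subset_interior_of_disjoint_frontier {X : Type*} [TopologicalSpace X] {s t : Set X}
    (hs : IsPreconnected s) (hst : Disjoint s (frontier t)) (hne : (s ∩ interior t).Nonempty) :
    s ⊆ interior t := by
  refine hs.subset_left_of_subset_union isOpen_interior isClosed_closure.isOpen_compl
    (disjoint_compl_right_iff_subset.2 interior_subset_closure) (fun x hx => ?_) hne
  by_contra! hx'
  simp only [mem_union, mem_compl_iff, not_or, not_not] at hx'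
  exact hst.notMem_of_mem_left hx ⟨hx'.2, hx'.1⟩

lemma isPreconnected_halfBall_diff_center (p : Plane) (ε θ : ℝ) :
    IsPreconnected ((ball p ε ∩ {z | ⟪dir θ, p⟫_ℝ ≤ ⟪dir θ, z⟫_ℝ}) \ {p}) := by
  set f := innerSL ℝ (dir θ)
  have hsurj : Function.Surjective f := fun t => ⟨t • dir θ, by simp [f]⟩
  have hconv : Convex ℝ (ball p ε ∩ f ⁻¹' Ioi (f p)) :=
    (convex_ball p ε).inter ((convex_Ioi _).linear_preimage f.toLinearMap)
  refine hconv.isPreconnected.subset_closure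
    (fun z hz => ⟨⟨hz.1, le_of_lt (show f p < f z from hz.2)⟩, ?_⟩)
    fun z hz => isOpen_ball.inter_closure ⟨hz.1.1, ?_⟩
  · rintro rfl
    exact lt_irrefl (f z) hz.2
  · rw [f.closure_preimage hsurj, closure_Ioi]
    exact hz.1.2

variable {lam R r a b θ φ : ℝ} {K U : Set Plane} {c p : Plane}

lemma exists_mem_ball_inner_lt (hK : Convex ℝ K) (hp : p ∈ K) (hq : q ∈ K)
    (hlt : ⟪dir θ, p⟫_ℝ < ⟪dir θ, q⟫_ℝ) {ε : ℝ} (hε : 0 < ε) :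
    ∃ z ∈ K, z ∈ ball p ε ∧ ⟪dir θ, p⟫_ℝ < ⟪dir θ, z⟫_ℝ := by
  set f : ℝ → Plane := fun t => AffineMap.lineMap (k := ℝ) p q t with hf
  have hcont : Continuous f := AffineMap.lineMap_continuous
  have hnear : ∀ᶠ t in 𝓝[>] (0 : ℝ), f t ∈ ball p ε ∧ t < 1 :=
    nhdsWithin_le_nhds <| ((hcont.continuousAt (x := 0)).eventually_mem
      (by simpa [hf] using ball_mem_nhds p hε)).and (gt_mem_nhds one_pos)
  obtain ⟨t, ⟨htε, ht1⟩, ht0 : 0 < t⟩ := (hnear.and self_mem_nhdsWithin).exists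
  refine ⟨f t, hK.lineMap_mem hp hq ⟨ht0.le, ht1.le⟩, htε, ?_⟩
  simp only [hf, AffineMap.lineMap_apply_module', inner_add_right, inner_smul_right,
    inner_sub_right]
  linarith [mul_pos ht0 (sub_pos.2 hlt)]

/-- If some point of `K` were beyond the tangent line of the disc at `p`, then the closed half-disc
around `p` beyond that line, which meets the boundary only in `p`, would lie in the interior apart
from `p`; but it contains `p` between two of its other points. -/
lemma isSupportPt_of_barrier (hK : IsPlanarConvexBody K) (hp : p ∈ frontier K) (hU : U ∈ 𝓝 p)
    (hUc : U ∩ frontier K ⊆ closedBall (p - r • dir θ) r) : IsSupportPt K θ p := by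
  have hpK : p ∈ K := hK.isCompact.isClosed.frontier_subset hp
  refine ⟨hpK, fun q hq => ?_⟩
  by_contra! hlt
  obtain ⟨ε, hε, hball⟩ := Metric.mem_nhds_iff.1 hU
  set D := (ball p ε ∩ {z | ⟪dir θ, p⟫_ℝ ≤ ⟪dir θ, z⟫_ℝ}) \ {p}
  have hdisj : Disjoint D (frontier K) := disjoint_left.2 fun z ⟨⟨hzε, hzp⟩, hne⟩ hz => by
    refine hne ?_
    rw [mem_singleton_iff,
      eq_add_smul_dir_of_le_inner (θ := θ) (hUc ⟨hball hzε, hz⟩) (by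
        rw [inner_sub_right, inner_smul_right, inner_dir_dir, sub_self, cos_zero]
        simpa using hzp),
      sub_add_cancel]
  have hmeet : (D ∩ interior K).Nonempty := by
    obtain ⟨z, hzK, hzε, hlt'⟩ := exists_mem_ball_inner_lt hK.convex hpK hq hlt hε
    have hzD : z ∈ D := ⟨⟨hzε, hlt'.le⟩, fun h => hlt'.ne' (by rw [mem_singleton_iff.1 h])⟩
    exact ⟨z, hzD, by_contra fun hzi => hdisj.notMem_of_mem_left hzD ⟨subset_closure hzK, hzi⟩⟩
  have hside {s : ℝ} (hs : |s| = ε / 2) : p + s • dir (θ + π / 2) ∈ interior K := by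
    refine subset_interior_of_disjoint_frontier (isPreconnected_halfBall_diff_center p ε θ)
      hdisj hmeet ⟨⟨?_, ?_⟩, ?_⟩
    · rw [mem_ball, dist_self_add_left, norm_smul, norm_dir, mul_one, Real.norm_eq_abs, hs]
      linarith
    · simp [inner_add_right, inner_smul_right, inner_dir_dir]
    · rw [mem_singleton_iff, add_eq_left, ← norm_eq_zero, norm_smul, norm_dir, mul_one,
        Real.norm_eq_abs, hs]
      positivity
  have hmid := hK.convex.interior (hside (s := ε / 2) (abs_of_pos (by positivity)))
    (hside (s := -(ε / 2)) (by rw [abs_neg, abs_of_pos (by positivity)]))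
    one_half_pos.le one_half_pos.le (by norm_num)
  refine hp.2 ?_
  convert hmid using 1
  module

lemma exists_barrier (hK : IsLamConvexBody lam K) (hp : p ∈ frontier K) :
    ∃ θ, IsSupportPt K θ p ∧
      ∀ᶠ z in 𝓝 p, z ∈ frontier K → z ∈ closedBall (p - (1 / lam) • dir θ) (1 / lam) := by
  obtain ⟨U, hU, c, hc, hUc⟩ := hK.barrier p hp
  obtain ⟨θ, hθ⟩ := exists_eq_norm_smul_dir (p - c)
  rw [mem_sphere_iff_norm.1 hc] at hθ
  obtain rfl : c = p - (1 / lam) • dir θ := by rw [← hθ, sub_sub_cancel]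
  exact ⟨θ, isSupportPt_of_barrier hK.toIsPlanarConvexBody hp hU hUc,
    mem_of_superset hU fun z hz hzK => hUc ⟨hz, hzK⟩⟩

lemma frequently_isSupportPt (hK : IsPlanarConvexBody K) (ha : IsSupportPt K a p)
    (hθ : IsSupportPt K θ p) (hne : dir θ ≠ dir a) : ∃ᶠ φ in 𝓝[≠] a, IsSupportPt K φ p := by
  obtain ⟨b, hb, hbθ⟩ := dir_periodic.exists_mem_Ioc two_pi_pos θ (a - π)
  have hbp : IsSupportPt K b p := by rwa [IsSupportPt, hbθ] at hθ
  rcases lt_trichotomy a b with hab | rfl | hba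
  · have hbπ : b ≠ a + π := fun h => not_isSupportPt_add_pi hK ha (h ▸ hbp)
    have hbπ' : b < a + π := lt_of_le_of_ne (by linarith [hb.2]) hbπ
    have hright : ∀ᶠ φ in 𝓝[>] a, IsSupportPt K φ p := by
      filter_upwards [Ioo_mem_nhdsGT hab] with φ hφ
      exact ha.of_mem_Icc hbp ⟨hφ.1.le, hφ.2.le⟩ (by linarith)
    exact hright.frequently.filter_mono (nhdsGT_le_nhdsNE a)
  · exact absurd hbθ hne
  · have hleft : ∀ᶠ φ in 𝓝[<] a, IsSupportPt K φ p := by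
      filter_upwards [Ioo_mem_nhdsLT hba] with φ hφ
      exact hbp.of_mem_Icc ha ⟨hφ.1.le, hφ.2.le⟩ (by linarith [hb.1])
    exact hleft.frequently.filter_mono (nhdsLT_le_nhdsNE a)

lemma frequently_supportFn_le (hlam : 0 < lam) (hK : IsLamConvexBody lam K) (a : ℝ) :
    ∃ᶠ φ in 𝓝[≠] a,
      supportFn K φ ≤ ⟪dir φ, supportPt K a⟫_ℝ + 1 / lam * (1 - cos (φ - a)) := by
  have hb := hK.toIsPlanarConvexBody
  have ha := isSupportPt_supportPt hb a
  obtain ⟨θ, hθ, hball⟩ := exists_barrier hK ha.mem_frontier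
  by_cases hdir : dir θ = dir a
  · refine Eventually.frequently ?_
    filter_upwards [nhdsWithin_le_nhds ((continuous_supportPt hK).continuousAt.eventually hball)]
      with φ hφ
    have := inner_dir_le_of_mem_closedBall
      (hφ (isSupportPt_supportPt hb φ).mem_frontier) φ
    rw [inner_sub_right, inner_smul_right, hdir, inner_dir_dir] at this
    rw [supportFn]
    linarith
  · refine (frequently_isSupportPt hb ha hθ hdir).mono fun φ hφ => ?_
    rw [supportFn, ← hφ.eq_supportPt hK]
    have := cos_le_one (φ - a)
    exact le_add_of_nonneg_right (mul_nonneg (by positivity) (by linarith))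

lemma supportPt_eq_of_touch (hK : IsLamConvexBody lam K)
    (hle : ∀ᶠ φ in 𝓝 a, ⟪dir φ, c⟫_ℝ + R ≤ supportFn K φ)
    (heq : supportFn K a = ⟪dir a, c⟫_ℝ + R) : supportPt K a = c + R • dir a := by
  have hmin : IsLocalMin (fun φ => supportFn K φ - ⟪dir φ, c⟫_ℝ) a :=
    hle.mono fun φ hφ => by linarith
  have hderiv := hmin.hasDerivAt_eq_zero <| (hasDerivAt_supportFn hK a).sub <|
    (hasDerivAt_dir a).inner ℝ (hasDerivAt_const a c)
  have hnormal : ⟪dir a, supportPt K a - c⟫_ℝ = R := by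
    rw [inner_sub_right, ← supportFn, heq, add_sub_cancel_left]
  have htangent : ⟪dir (a + π / 2), supportPt K a - c⟫_ℝ = 0 := by
    simpa [inner_sub_right] using hderiv
  rw [← sub_eq_iff_eq_add', eq_inner_dir_smul_add a (supportPt K a - c), hnormal, htangent,
    zero_smul, add_zero]

lemma not_touch_of_one_div_lt (hlam : 0 < lam) (hK : IsLamConvexBody lam K) (hR : 1 / lam < R)
    (hle : ∀ᶠ φ in 𝓝 a, ⟪dir φ, c⟫_ℝ + R ≤ supportFn K φ) :
    supportFn K a ≠ ⟪dir a, c⟫_ℝ + R := fun heq => by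
  have hpt := supportPt_eq_of_touch hK hle heq
  have hcos : ∀ᶠ φ in 𝓝[≠] a, cos (φ - a) < 1 := by
    filter_upwards [nhdsWithin_le_nhds (Ioo_mem_nhds (sub_lt_self a two_pi_pos)
      (lt_add_of_pos_right a two_pi_pos)), self_mem_nhdsWithin] with φ hφ hne
    refine (cos_le_one _).lt_of_ne fun h1 => hne ?_
    rw [cos_eq_one_iff_of_lt_of_lt (by linarith [hφ.1]) (by linarith [hφ.2])] at h1
    exact sub_eq_zero.1 h1
  obtain ⟨φ, ⟨hφ, hφle⟩, hφcos⟩ := (((frequently_supportFn_le hlam hK a).and_eventually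
    (nhdsWithin_le_nhds hle)).and_eventually hcos).exists
  rw [hpt, inner_add_right, inner_smul_right, inner_dir_dir] at hφ
  nlinarith

end Barrier

section Rolling

lemma exists_mul_cos_le_of_neg {u : ℝ → ℝ} {a b τ : ℝ} (hu : ContinuousOn u (Icc a b))
    (hab : b - a < π) (ha : 0 ≤ u a) (hb : 0 ≤ u b) (hτ : τ ∈ Icc a b) (hneg : u τ < 0) :
    ∃ μ m, ∃ t ∈ Ioo a b, u t = μ * cos (t - m) ∧ ∀ s ∈ Icc a b, μ * cos (s - m) ≤ u s := by
  set m := (a + b) / 2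
  have hcos {s} (hs : s ∈ Icc a b) : 0 < cos (s - m) :=
    cos_pos_of_mem_Ioo ⟨by grind, by grind⟩
  obtain ⟨t, ht, hmin⟩ := isCompact_Icc.exists_isMinOn ⟨τ, hτ⟩
    (hu.div (by fun_prop : ContinuousOn (fun s => cos (s - m)) _) fun s hs => (hcos hs).ne')
  have htneg : u t / cos (t - m) < 0 := (hmin hτ).trans_lt (div_neg_of_neg_of_pos hneg (hcos hτ))
  have hne {s} (hs : s ∈ Icc a b) (hus : 0 ≤ u s) : s ≠ t := by
    rintro rfl
    exact htneg.not_ge (div_nonneg hus (hcos hs).le)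
  have hab' := hτ.1.trans hτ.2
  exact ⟨u t / cos (t - m), m, t, ⟨ht.1.lt_of_ne (hne (left_mem_Icc.2 hab') ha),
    ht.2.lt_of_ne' (hne (right_mem_Icc.2 hab') hb)⟩, (div_mul_cancel₀ _ (hcos ht).ne').symm,
    fun s hs => (le_div_iff₀ (hcos hs)).1 (hmin hs)⟩

lemma mul_sin_pos {x : ℝ} (hx : x ≠ 0) (hxπ : |x| < π) : 0 < x * sin x := by
  rw [abs_lt] at hxπ
  rcases hx.lt_or_gt with h | h
  · exact mul_pos_of_neg_of_neg h (sin_neg_of_neg_of_neg_pi_lt h hxπ.1)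
  · exact mul_pos h (sin_pos_of_pos_of_lt_pi h hxπ.2)

variable {lam R a b φ : ℝ} {K : Set Plane} {c : Plane}

/-- Otherwise the disc could be shifted until it touches from below at an interior angle. -/
lemma inner_add_le_supportFn_of_endpoints (hlam : 0 < lam) (hK : IsLamConvexBody lam K)
    (hR : 1 / lam < R) (hab : b - a < π) (ha : ⟪dir a, c⟫_ℝ + R ≤ supportFn K a)
    (hb : ⟪dir b, c⟫_ℝ + R ≤ supportFn K b) (hφ : φ ∈ Icc a b) :
    ⟪dir φ, c⟫_ℝ + R ≤ supportFn K φ := by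
  by_contra! hlt
  have hcont : Continuous (supportFn K) :=
    continuous_iff_continuousAt.2 fun θ => (hasDerivAt_supportFn hK θ).continuousAt
  obtain ⟨μ, m, t, ht, heq, hle⟩ := exists_mul_cos_le_of_neg (τ := φ)
    (u := fun θ => supportFn K θ - (⟪dir θ, c⟫_ℝ + R)) (by fun_prop) hab
    (sub_nonneg.2 ha) (sub_nonneg.2 hb) hφ (sub_neg.2 hlt)
  have hshift (θ) : ⟪dir θ, c + μ • dir m⟫_ℝ = ⟪dir θ, c⟫_ℝ + μ * cos (θ - m) := by
    rw [inner_add_right, inner_smul_right, inner_dir_dir]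
  refine not_touch_of_one_div_lt hlam hK hR (a := t) (c := c + μ • dir m) ?_ ?_
  · filter_upwards [Icc_mem_nhds ht.1 ht.2] with θ hθ
    rw [hshift]
    linarith [hle θ hθ]
  · rw [hshift]
    linarith

lemma mul_inner_supportPt_sub_nonneg (hlam : 0 < lam) (hK : IsLamConvexBody lam K)
    (hR : 1 / lam < R) (hab : |b - a| < π) (ha : ⟪dir a, c⟫_ℝ + R = supportFn K a)
    (hb : ⟪dir b, c⟫_ℝ + R ≤ supportFn K b) :
    0 ≤ (b - a) * ⟪dir (a + π / 2), supportPt K a - c⟫_ℝ := by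
  have hle {φ : ℝ} (hφ : φ ∈ uIcc a b) : ⟪dir φ, c⟫_ℝ + R ≤ supportFn K φ := by
    rw [abs_lt] at hab
    rcases le_total a b with h | h
    · rw [uIcc_of_le h] at hφ
      exact inner_add_le_supportFn_of_endpoints hlam hK hR hab.2 ha.le hb hφ
    · rw [uIcc_of_ge h] at hφ
      exact inner_add_le_supportFn_of_endpoints hlam hK hR (by linarith) hb ha.le hφ
  have hmin : IsLocalMinOn (fun φ => supportFn K φ - ⟪dir φ, c⟫_ℝ) (uIcc a b) a :=
    IsMinOn.localize fun φ hφ => by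
      simp only [mem_ofPred_eq]
      linarith [hle hφ]
  have hderiv := (hasDerivAt_supportFn hK a).sub <|
    (hasDerivAt_dir a).inner ℝ (hasDerivAt_const a c)
  have hnonneg := hmin.hasFDerivWithinAt_nonneg hderiv.hasFDerivAt.hasFDerivWithinAt
    (sub_mem_posTangentConeAt_of_segment_subset (segment_eq_uIcc a b).subset)
  simpa [inner_sub_right] using hnonneg

/-- The disc of radius `R` touching both the supporting lines at `a` and at `b` would touch the
former on the wrong side of the support point. -/
theorem supportFn_le_inner_add (hlam : 0 < lam) (hK : IsLamConvexBody lam K) (hab : |b - a| < π) :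
    supportFn K b ≤ ⟪dir b, supportPt K a⟫_ℝ + 1 / lam * (1 - cos (b - a)) := by
  by_contra! hlt
  set p := supportPt K a
  have hne : b ≠ a := by
    rintro rfl
    simp [supportFn, p] at hlt
  obtain ⟨R, hRlt, hR⟩ : ∃ R, ⟪dir b, p⟫_ℝ + R * (1 - cos (b - a)) < supportFn K b
      ∧ 1 / lam < R := by
    have hcont : Continuous fun R : ℝ => ⟪dir b, p⟫_ℝ + R * (1 - cos (b - a)) := by fun_prop
    have hnear : ∀ᶠ R in 𝓝[>] (1 / lam), ⟪dir b, p⟫_ℝ + R * (1 - cos (b - a)) < supportFn K b :=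
      nhdsWithin_le_nhds (hcont.continuousAt.eventually_lt continuousAt_const hlt)
    exact (hnear.and self_mem_nhdsWithin).exists
  set ν := supportFn K b - (⟪dir b, p⟫_ℝ + R * (1 - cos (b - a)))
  have hsin : 0 < (b - a) * sin (b - a) := mul_sin_pos (sub_ne_zero.2 hne) hab
  set η := ν / sin (b - a)
  have hη : η * sin (b - a) = ν := div_mul_cancel₀ _ (right_ne_zero_of_mul hsin.ne')
  set c := p - R • dir a + η • dir (a + π / 2)
  have hc (θ) : ⟪dir θ, c⟫_ℝ + R
      = ⟪dir θ, p⟫_ℝ + R * (1 - cos (θ - a)) + η * sin (θ - a) := by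
    rw [inner_add_right, inner_sub_right, inner_smul_right, inner_smul_right, inner_dir_dir,
      inner_dir_dir, ← sub_sub, cos_sub_pi_div_two]
    ring
  have hca : ⟪dir a, c⟫_ℝ + R = supportFn K a := by simp [hc, supportFn, p]
  have hcb : ⟪dir b, c⟫_ℝ + R = supportFn K b := by rw [hc, hη]; ring
  have hinner : ⟪dir (a + π / 2), p - c⟫_ℝ = -η := by
    rw [show p - c = R • dir a - η • dir (a + π / 2) by simp only [c]; abel, inner_sub_right,
      inner_smul_right, inner_smul_right, inner_dir_dir, inner_dir_dir]
    simp
  have htangent := mul_inner_supportPt_sub_nonneg hlam hK hR hab hca hcb.le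
  rw [hinner] at htangent
  nlinarith [sub_pos.2 hRlt, mul_nonneg htangent (sq_nonneg (sin (b - a)))]

end Rolling

section SupportCurve

/-- A curve parametrised by normal angle: `X θ` is extremal in the direction `θ` among the points
whose angle is within `π` of `θ`. -/
def IsSupportCurve (X : ℝ → Plane) : Prop :=
  ∀ ⦃a b⦄, |b - a| < π → ⟪dir b, X a⟫_ℝ ≤ ⟪dir b, X b⟫_ℝ

namespace IsSupportCurve

variable {X Y : ℝ → Plane} {a b t : ℝ} {v : Plane}

lemma inner_dir_sub_nonpos (hX : IsSupportCurve X) (hab : |b - a| < π) :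
    ⟪dir a, X b - X a⟫_ℝ ≤ 0 := by
  rw [inner_sub_right, sub_nonpos]
  exact hX (by rwa [abs_sub_comm])

lemma inner_dir_add_pi_div_two_sub_nonneg (hX : IsSupportCurve X) (hab : a ≤ b)
    (hba : b ≤ a + π / 2) : 0 ≤ ⟪dir (a + π / 2), X b - X a⟫_ℝ := by
  rcases hab.eq_or_lt with rfl | hlt
  · simp
  have hδ : |b - a| < π := by rw [abs_of_pos (sub_pos.2 hlt)]; linarith [pi_pos]
  have hnormal := hX.inner_dir_sub_nonpos hδ
  have hb : 0 ≤ ⟪dir b, X b - X a⟫_ℝ := by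
    rw [inner_sub_right]
    exact sub_nonneg.2 (hX hδ)
  rw [inner_dir_eq_cos_mul_add a] at hb
  have hcos : 0 ≤ cos (b - a) := cos_nonneg_of_mem_Icc ⟨by linarith, by linarith⟩
  have hsin : 0 < sin (b - a) := sin_pos_of_pos_of_lt_pi (sub_pos.2 hlt) (by linarith)
  refine nonneg_of_mul_nonneg_right ?_ hsin
  linarith [mul_nonpos_of_nonneg_of_nonpos hcos hnormal]

lemma inner_sub_sub_nonneg (hX : IsSupportCurve X) (hY : IsSupportCurve Y) (hab : a ≤ b)
    (hba : b ≤ a + π / 2) : 0 ≤ ⟪X b - X a, Y b - Y a⟫_ℝ := by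
  have hδ : |b - a| < π := by rw [abs_of_nonneg (sub_nonneg.2 hab)]; linarith [pi_pos]
  rw [inner_eq_inner_dir_mul_add a]
  exact add_nonneg
    (mul_nonneg_of_nonpos_of_nonpos (hX.inner_dir_sub_nonpos hδ) (hY.inner_dir_sub_nonpos hδ))
    (mul_nonneg (hX.inner_dir_add_pi_div_two_sub_nonneg hab hba)
      (hY.inner_dir_add_pi_div_two_sub_nonneg hab hba))

lemma inner_dir_deriv_eq_zero (hX : IsSupportCurve X) (h : HasDerivAt X v t) :
    ⟪dir t, v⟫_ℝ = 0 := by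
  have hmax : IsLocalMax (fun φ => ⟪dir t, X φ⟫_ℝ) t := by
    filter_upwards [ball_mem_nhds t pi_pos] with φ hφ
    exact hX (by rwa [abs_sub_comm])
  simpa using hmax.hasDerivAt_eq_zero ((hasDerivAt_const t (dir t)).inner ℝ h)

lemma inner_dir_add_pi_div_two_deriv_nonneg (hX : IsSupportCurve X) (h : HasDerivAt X v t) :
    0 ≤ ⟪dir (t + π / 2), v⟫_ℝ := by
  have hmin : IsMinOn (fun φ => ⟪dir (t + π / 2), X φ⟫_ℝ) (Icc t (t + π / 2)) t := fun φ hφ => by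
    have := hX.inner_dir_add_pi_div_two_sub_nonneg hφ.1 hφ.2
    rwa [inner_sub_right, sub_nonneg] at this
  have hnonneg := hmin.localize.hasFDerivWithinAt_nonneg
    ((hasDerivAt_const t (dir (t + π / 2))).inner ℝ h).hasFDerivAt.hasFDerivWithinAt
    (sub_mem_posTangentConeAt_of_segment_subset (y := t + π / 2)
      (segment_eq_Icc (by linarith [pi_pos])).subset)
  simp only [ContinuousLinearMap.toSpanSingleton_apply, add_sub_cancel_left, smul_eq_mul,
    inner_zero_left, add_zero] at hnonneg
  exact nonneg_of_mul_nonneg_right hnonneg (by positivity)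

end IsSupportCurve

lemma forall_of_forall_le_add_of_trans {P : ℝ → ℝ → Prop} {δ : ℝ} (hδ : 0 < δ)
    (hshort : ∀ a b, a ≤ b → b ≤ a + δ → P a b)
    (htrans : ∀ a m b, a ≤ m → m ≤ b → P a m → P m b → P a b) {a b : ℝ} (hab : a ≤ b) :
    P a b := by
  have hdouble (n : ℕ) : ∀ a b, a ≤ b → b ≤ a + 2 ^ n * δ → P a b := by
    induction n with
    | zero => simpa using hshort
    | succ n ih =>
      intro a b hab hba
      rw [pow_succ] at hba
      exact htrans a ((a + b) / 2) b (by linarith) (by linarith)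
        (ih _ _ (by linarith) (by linarith)) (ih _ _ (by linarith) (by linarith))
  obtain ⟨n, hn⟩ := pow_unbounded_of_one_lt ((b - a) / δ) one_lt_two
  rw [div_lt_iff₀ hδ] at hn
  exact hdouble n a b hab (by linarith)

lemma lipschitzWith_of_dist_le_mul_of_le {X : Type*} [PseudoMetricSpace X] {f : ℝ → X} {C : NNReal}
    {δ : ℝ} (hδ : 0 < δ) (h : ∀ a b, a ≤ b → b ≤ a + δ → dist (f a) (f b) ≤ C * (b - a)) :
    LipschitzWith C f := by
  refine LipschitzWith.of_dist_le_mul fun a b => ?_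
  wlog hab : a ≤ b generalizing a b
  · rw [dist_comm, dist_comm a]
    exact this b a (le_of_not_ge hab)
  rw [Real.dist_eq, abs_sub_comm, abs_of_nonneg (sub_nonneg.2 hab)]
  refine forall_of_forall_le_add_of_trans hδ h (fun a m b _ _ ham hmb => ?_) hab
  linarith [dist_triangle (f a) (f m) (f b)]

variable {lam a b t : ℝ} {K : Set Plane}

lemma isSupportCurve_supportPt (hK : IsPlanarConvexBody K) : IsSupportCurve (supportPt K) :=
  fun a b _ => inner_dir_le_supportFn hK (isSupportPt_supportPt hK a).1 b

lemma isSupportCurve_smul_dir_sub_supportPt (hlam : 0 < lam) (hK : IsLamConvexBody lam K) :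
    IsSupportCurve fun θ => (1 / lam) • dir θ - supportPt K θ := fun a b hab => by
  have := supportFn_le_inner_add hlam hK hab
  rw [inner_sub_right, inner_sub_right, inner_smul_right, inner_smul_right, inner_dir_dir,
    inner_dir_dir, sub_self, cos_zero, ← supportFn]
  linarith

/-- Over a short angle, the chords of `supportPt K` and of the complementary curve
`(1 / lam) • dir - supportPt K` make an acute angle, so the former is at most their sum, a chord of
a circle of radius `1 / lam`. -/
theorem lipschitzWith_supportPt (hlam : 0 < lam) (hK : IsLamConvexBody lam K) :
    LipschitzWith (1 / lam).toNNReal (supportPt K) := by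
  refine lipschitzWith_of_dist_le_mul_of_le pi_div_two_pos fun a b hab hba => ?_
  have hacute := (isSupportCurve_supportPt hK.toIsPlanarConvexBody).inner_sub_sub_nonneg
    (isSupportCurve_smul_dir_sub_supportPt hlam hK) hab hba
  set d := supportPt K b - supportPt K a
  set e := (1 / lam) • dir b - supportPt K b - ((1 / lam) • dir a - supportPt K a)
  have hde : ‖d‖ ≤ ‖d + e‖ := by
    refine le_of_sq_le_sq ?_ (norm_nonneg _)
    rw [norm_add_sq_real]
    linarith [sq_nonneg ‖e‖]
  have hsum : d + e = (1 / lam) • (dir b - dir a) := by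
    simp only [d, e]
    module
  have hchord : ‖dir b - dir a‖ ≤ b - a := by
    have := lipschitzWith_dir.dist_le_mul b a
    rwa [dist_eq_norm, Real.dist_eq, abs_of_nonneg (sub_nonneg.2 hab), NNReal.coe_one,
      one_mul] at this
  rw [dist_comm, dist_eq_norm, Real.coe_toNNReal _ (by positivity)]
  calc ‖d‖ ≤ ‖(1 / lam) • (dir b - dir a)‖ := hsum ▸ hde
    _ = 1 / lam * ‖dir b - dir a‖ := norm_smul_of_nonneg (by positivity) _
    _ ≤ 1 / lam * (b - a) := by gcongr

/-- The radius of curvature of the boundary of `K` at the normal angle `θ`, in units of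
`1 / lam`; it is `0` where `supportPt K` is not differentiable. -/
noncomputable def density (lam : ℝ) (K : Set Plane) (θ : ℝ) : ℝ :=
  lam * ⟪dir (θ + π / 2), deriv (supportPt K) θ⟫_ℝ

lemma isUnitDensity_density (hlam : 0 < lam) (hK : IsLamConvexBody lam K) :
    IsUnitDensity (density lam K) := by
  have hbounds (t) : 0 ≤ density lam K t ∧ density lam K t ≤ 1 := by
    by_cases hdiff : DifferentiableAt ℝ (supportPt K) t
    · have hderiv := hdiff.hasDerivAt
      have hlower := (isSupportCurve_supportPt
        hK.toIsPlanarConvexBody).inner_dir_add_pi_div_two_deriv_nonneg hderiv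
      have hupper := (isSupportCurve_smul_dir_sub_supportPt
        hlam hK).inner_dir_add_pi_div_two_deriv_nonneg
          (((hasDerivAt_dir t).const_smul (1 / lam)).sub hderiv)
      rw [inner_sub_right, inner_smul_right, inner_dir_dir, sub_self, cos_zero, mul_one,
        sub_nonneg, le_div_iff₀' hlam] at hupper
      exact ⟨mul_nonneg hlam.le hlower, hupper⟩
    · simp [density, deriv_zero_of_not_differentiableAt hdiff]
  have := measurable_deriv (supportPt K)
  exact ⟨by unfold density; fun_prop, fun t => (hbounds t).1, fun t => (hbounds t).2⟩

lemma density_periodic (lam : ℝ) (K : Set Plane) :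
    Function.Periodic (density lam K) (2 * π) := fun t => by
  have hderiv : deriv (supportPt K) (t + 2 * π) = deriv (supportPt K) t := by
    rw [← deriv_comp_add_const, funext (supportPt_periodic K)]
  rw [density, density, hderiv, add_right_comm, dir_periodic]

lemma ae_hasDerivAt_supportPt (hlam : 0 < lam) (hK : IsLamConvexBody lam K) :
    ∀ᵐ t, HasDerivAt (supportPt K) ((1 / lam * density lam K t) • dir (t + π / 2)) t := by
  filter_upwards [(lipschitzWith_supportPt hlam hK).ae_differentiableAt] with t ht
  refine ht.hasDerivAt.congr_deriv ?_
  rw [density, ← mul_assoc, one_div_mul_cancel hlam.ne', one_mul]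
  conv_lhs => rw [eq_inner_dir_smul_add t (deriv (supportPt K) t),
    (isSupportCurve_supportPt hK.toIsPlanarConvexBody).inner_dir_deriv_eq_zero ht.hasDerivAt,
    zero_smul, zero_add]

lemma inner_dir_supportPt_sub (hlam : 0 < lam) (hK : IsLamConvexBody lam K) (φ a b : ℝ) :
    ⟪dir φ, supportPt K b - supportPt K a⟫_ℝ
      = 1 / lam * ∫ s in a..b, density lam K s * sin (φ - s) := by
  have hlip := (innerSL ℝ (dir φ)).lipschitz.comp (lipschitzWith_supportPt hlam hK)
  rw [inner_sub_right, ← intervalIntegral.integral_const_mul]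
  refine (intervalIntegral_eq_sub_of_ae_hasDerivAt
    hlip.lipschitzOnWith.absolutelyContinuousOnInterval ?_).symm
  filter_upwards [ae_hasDerivAt_supportPt hlam hK] with t ht
  refine ((hasDerivAt_const t (dir φ)).inner ℝ ht).congr_deriv ?_
  rw [inner_smul_right, inner_dir_dir, inner_zero_left, add_zero, ← sub_sub, cos_sub_pi_div_two]
  ring

lemma supportFn_eq (hlam : 0 < lam) (hK : IsLamConvexBody lam K) (a t : ℝ) :
    supportFn K t = ⟪dir t, supportPt K a⟫_ℝ
      + 1 / lam * ∫ s in a..t, density lam K s * sin (t - s) := by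
  rw [← inner_dir_supportPt_sub hlam hK, inner_sub_right, supportFn]
  ring

lemma dist_supportPt_le (hlam : 0 < lam) (hK : IsLamConvexBody lam K) (hab : a ≤ b) :
    dist (supportPt K a) (supportPt K b) ≤ 1 / lam * mass (density lam K) a b := by
  have hρ := isUnitDensity_density hlam hK
  obtain ⟨φ, hφ⟩ := exists_eq_norm_smul_dir (supportPt K b - supportPt K a)
  have hnorm : ‖supportPt K b - supportPt K a‖ = ⟪dir φ, supportPt K b - supportPt K a⟫_ℝ := by
    conv_rhs => rw [hφ, inner_smul_right, inner_dir_dir, sub_self, cos_zero, mul_one]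
  rw [dist_comm, dist_eq_norm, hnorm, inner_dir_supportPt_sub hlam hK]
  gcongr
  exact intervalIntegral.integral_mono_on hab (hρ.intervalIntegrable_mul (by fun_prop) a b)
    (hρ.intervalIntegrable a b) fun s _ => mul_le_of_le_one_right (hρ.nonneg s) (sin_le_one _)

end SupportCurve

section Length

lemma hausdorffMeasure_image_le_of_dist_le {α X : Type*} [MetricSpace X] [MeasurableSpace X]
    [BorelSpace X] {f : α → X} {g : α → ℝ} (h : ∀ a b, dist (f a) (f b) ≤ dist (g a) (g b))
    (A : Set α) : Measure.hausdorffMeasure 1 (f '' A) ≤ volume (g '' A) := by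
  rcases isEmpty_or_nonempty α
  · simp [eq_empty_of_isEmpty A]
  set y : ℝ → X := fun σ => f (Function.invFun g σ)
  have hyg (a) : y (g a) = f a := by
    rw [← dist_le_zero]
    simpa [Function.invFun_eq (f := g) ⟨a, rfl⟩] using h (Function.invFun g (g a)) a
  have hlip : LipschitzOnWith 1 y (g '' A) := by
    refine LipschitzOnWith.of_dist_le_mul ?_
    rintro _ ⟨a, _, rfl⟩ _ ⟨b, _, rfl⟩
    simpa [hyg] using h a b
  have hmeasure := hlip.hausdorffMeasure_image_le (d := 1) zero_le_one
  rw [image_image, hausdorffMeasure_real] at hmeasure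
  simpa [hyg] using hmeasure

variable {lam a b m s t : ℝ} {K : Set Plane}

lemma frontier_eq_image_supportPt (hK : IsLamConvexBody lam K) (a : ℝ) :
    frontier K = supportPt K '' Icc a (a + 2 * π) := by
  have hb := hK.toIsPlanarConvexBody
  refine Subset.antisymm (fun p hp => ?_) ?_
  · obtain ⟨θ, hθ⟩ := exists_isSupportPt_of_mem_frontier hb hp
    obtain ⟨φ, hφ, hdir⟩ := dir_periodic.exists_mem_Ioc two_pi_pos θ a
    exact ⟨φ, Ioc_subset_Icc_self hφ, by rw [hθ.eq_supportPt hK, supportPt_congr hdir]⟩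
  · rintro _ ⟨θ, _, rfl⟩
    exact (isSupportPt_supportPt hb θ).mem_frontier

lemma hausdorffMeasure_arc_le (hlam : 0 < lam) (hK : IsLamConvexBody lam K) (a b : ℝ) :
    Measure.hausdorffMeasure 1 (supportPt K '' Icc a b)
      ≤ ENNReal.ofReal (1 / lam * mass (density lam K) a b) := by
  have hρ := isUnitDensity_density hlam hK
  set g : ℝ → ℝ := fun t => 1 / lam * mass (density lam K) a t
  have hdist (s t) : dist (supportPt K s) (supportPt K t) ≤ dist (g s) (g t) := by
    wlog hst : s ≤ t generalizing s t
    · rw [dist_comm, dist_comm (g s)]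
      exact this t s (le_of_not_ge hst)
    refine (dist_supportPt_le hlam hK hst).trans ?_
    rw [dist_comm, Real.dist_eq, ← mul_sub, ← hρ.mass_add_mass a s t, add_sub_cancel_left]
    exact le_abs_self _
  have hsub : g '' Icc a b ⊆ Icc 0 (1 / lam * mass (density lam K) a b) := by
    rintro _ ⟨t, ht, rfl⟩
    have := hρ.mass_nonneg ht.1
    have := hρ.mass_nonneg ht.2
    have := hρ.mass_add_mass a t b
    exact ⟨by positivity, mul_le_mul_of_nonneg_left (by linarith) (by positivity)⟩
  refine (hausdorffMeasure_image_le_of_dist_le hdist _).trans ((measure_mono hsub).trans ?_)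
  rw [Real.volume_Icc, sub_zero]

lemma mul_mass_le_hausdorffMeasure_arc (hlam : 0 < lam) (hK : IsLamConvexBody lam K) (hab : a ≤ b)
    (hb : b ≤ a + π / 2) : ENNReal.ofReal (1 / lam * (cos (b - a) * mass (density lam K) a b))
      ≤ Measure.hausdorffMeasure 1 (supportPt K '' Icc a b) := by
  have hρ := isUnitDensity_density hlam hK
  set f : Plane → ℝ := fun p => ⟪dir (a + π / 2), p⟫_ℝ
  have hf : LipschitzWith 1 f := LipschitzWith.of_dist_le_mul fun p q => by
    rw [Real.dist_eq, ← inner_sub_right, dist_eq_norm]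
    simpa using abs_real_inner_le_norm (dir (a + π / 2)) (p - q)
  have hproj := (hf.lipschitzOnWith (s := supportPt K '' Icc a b)).hausdorffMeasure_image_le
    (d := 1) zero_le_one
  rw [ENNReal.coe_one, ENNReal.one_rpow, one_mul, hausdorffMeasure_real, image_image] at hproj
  have hcont : ContinuousOn (fun t => f (supportPt K t)) (Icc a b) :=
    (hf.continuous.comp (continuous_supportPt hK)).continuousOn
  refine le_trans ?_ ((measure_mono (intermediate_value_Icc hab hcont)).trans hproj)
  rw [Real.volume_Icc, ← inner_sub_right, inner_dir_supportPt_sub hlam hK]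
  gcongr
  rw [mass, ← intervalIntegral.integral_const_mul]
  refine intervalIntegral.integral_mono_on hab ((hρ.intervalIntegrable a b).const_mul _)
    (hρ.intervalIntegrable_mul (by fun_prop) a b) fun s hs => ?_
  rw [mul_comm, show a + π / 2 - s = π / 2 - (s - a) by ring, sin_pi_div_two_sub]
  exact mul_le_mul_of_nonneg_left (cos_le_cos_of_nonneg_of_le_pi (by linarith [hs.1])
    (by linarith [pi_pos]) (by linarith [hs.2])) (hρ.nonneg s)

lemma supportPt_eq_or_of_eq (hK : IsLamConvexBody lam K) (hs : 0 ≤ s) (hm : m ∈ Icc s t)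
    (ht : t ≤ 2 * π) (h : supportPt K s = supportPt K t) :
    supportPt K s = supportPt K m ∨ supportPt K s = supportPt K 0 := by
  have hb := hK.toIsPlanarConvexBody
  have hs_supp := isSupportPt_supportPt hb s
  have ht_supp := h ▸ isSupportPt_supportPt hb t
  rcases lt_trichotomy (t - s) π with hlt | heq | hgt
  · exact .inl ((hs_supp.of_mem_Icc ht_supp hm hlt).eq_supportPt hK)
  · exact absurd (by rwa [← heq, add_sub_cancel]) (not_isSupportPt_add_pi hb hs_supp)
  · have hs_supp' : IsSupportPt K (s + 2 * π) (supportPt K s) := by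
      rwa [IsSupportPt, dir_periodic]
    refine .inr ?_
    rw [(ht_supp.of_mem_Icc hs_supp' ⟨ht, by linarith⟩ (by linarith)).eq_supportPt hK]
    simpa using supportPt_periodic K 0

lemma hausdorffMeasure_arc_add (hK : IsLamConvexBody lam K) (ha : 0 ≤ a) (ham : a ≤ m)
    (hmb : m ≤ b) (hb : b ≤ 2 * π) : Measure.hausdorffMeasure 1 (supportPt K '' Icc a b)
      = Measure.hausdorffMeasure 1 (supportPt K '' Icc a m)
        + Measure.hausdorffMeasure 1 (supportPt K '' Icc m b) := by
  have hdisj : AEDisjoint (Measure.hausdorffMeasure 1) (supportPt K '' Icc a m)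
      (supportPt K '' Icc m b) := by
    have := Measure.nullSingletonClass_hausdorff Plane (d := 1) one_pos
    refine measure_mono_null (t := {supportPt K m, supportPt K 0}) ?_ ((toFinite _).measure_zero _)
    rintro _ ⟨⟨s, hs, rfl⟩, ⟨t, ht, hst⟩⟩
    exact supportPt_eq_or_of_eq hK (ha.trans hs.1) ⟨hs.2, ht.1⟩ (ht.2.trans hb) hst.symm
  rw [← Icc_union_Icc_eq_Icc ham hmb, image_union]
  exact measure_union₀
    (isCompact_Icc.image (continuous_supportPt hK)).measurableSet.nullMeasurableSet hdisj

lemma cos_mul_mass_le_hausdorffMeasure_frontier (hlam : 0 < lam) (hK : IsLamConvexBody lam K)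
    {δ : ℝ} (hδ : 0 < δ) (hδπ : δ ≤ π / 2) :
    ENNReal.ofReal (1 / lam * (cos δ * mass (density lam K) 0 (2 * π)))
      ≤ Measure.hausdorffMeasure 1 (frontier K) := by
  have hρ := isUnitDensity_density hlam hK
  have hcos : 0 ≤ cos δ := cos_nonneg_of_mem_Icc ⟨by linarith, hδπ⟩
  rw [frontier_eq_image_supportPt hK 0, zero_add]
  refine forall_of_forall_le_add_of_trans (P := fun a b => 0 ≤ a → b ≤ 2 * π →
    ENNReal.ofReal (1 / lam * (cos δ * mass (density lam K) a b))
      ≤ Measure.hausdorffMeasure 1 (supportPt K '' Icc a b)) hδ (fun a b hab hba _ _ => ?_)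
    (fun a m b ham hmb hP hQ ha hb => ?_) two_pi_pos.le le_rfl le_rfl
  · refine le_trans ?_ (mul_mass_le_hausdorffMeasure_arc hlam hK hab (by linarith))
    have := hρ.mass_nonneg hab
    have := cos_le_cos_of_nonneg_of_le_pi (sub_nonneg.2 hab) (by linarith) (by linarith : b - a ≤ δ)
    gcongr
  · have ham_nonneg := hρ.mass_nonneg ham
    have hmb_nonneg := hρ.mass_nonneg hmb
    rw [hausdorffMeasure_arc_add hK ha ham hmb hb, ← hρ.mass_add_mass a m b, mul_add, mul_add,
      ENNReal.ofReal_add (by positivity) (by positivity)]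
    exact add_le_add (hP ha (by linarith)) (hQ (by linarith) hb)

theorem hausdorffMeasure_frontier (hlam : 0 < lam) (hK : IsLamConvexBody lam K) :
    Measure.hausdorffMeasure 1 (frontier K)
      = ENNReal.ofReal (1 / lam * mass (density lam K) 0 (2 * π)) := by
  refine le_antisymm ?_ ?_
  · simpa [frontier_eq_image_supportPt hK 0] using hausdorffMeasure_arc_le hlam hK 0 (2 * π)
  · have hcont : Continuous fun δ =>
        ENNReal.ofReal (1 / lam * (cos δ * mass (density lam K) 0 (2 * π))) :=
      ENNReal.continuous_ofReal.comp (by fun_prop)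
    have hlim := (hcont.tendsto 0).mono_left (nhdsWithin_le_nhds (s := Ioi 0))
    rw [cos_zero, one_mul] at hlim
    refine le_of_tendsto hlim ?_
    filter_upwards [Ioc_mem_nhdsGT pi_div_two_pos] with δ hδ
    exact cos_mul_mass_le_hausdorffMeasure_frontier hlam hK hδ.1 hδ.2

theorem boundaryLength_eq (hlam : 0 < lam) (hK : IsLamConvexBody lam K) :
    boundaryLength K = 1 / lam * mass (density lam K) 0 (2 * π) := by
  have := (isUnitDensity_density hlam hK).mass_nonneg two_pi_pos.le
  rw [boundaryLength, hausdorffMeasure_frontier hlam hK, ENNReal.toReal_ofReal (by positivity)]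

end Length

section Area

variable {lam : ℝ} {K : Set Plane}

lemma volume_eq_lintegral_slice (hK : MeasurableSet K) :
    volume K = ∫⁻ x : ℝ, volume {y : ℝ | !₂[x, y] ∈ K} := by
  let e : Plane ≃ᵐ ℝ × ℝ :=
    (MeasurableEquiv.toLp 2 (Fin 2 → ℝ)).symm.trans MeasurableEquiv.finTwoArrow
  have he : MeasurePreserving e := (volume_preserving_finTwoArrow ℝ).comp
    (EuclideanSpace.volume_preserving_symm_measurableEquiv_toLp (Fin 2))
  rw [← (he.symm e).measure_preimage hK.nullMeasurableSet, Measure.volume_eq_prod,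
    Measure.prod_apply (e.symm.measurable hK)]
  rfl

/-- On a compact interval, a continuous map is a quotient map onto its closed image, so the factor
is continuous there, and Tietze's theorem extends it. -/
lemma exists_continuous_comp_eq {X Y : ℝ → ℝ} {a b : ℝ} (hX : Continuous X) (hY : Continuous Y)
    (h : ∀ s ∈ Icc a b, ∀ t ∈ Icc a b, X s = X t → Y s = Y t) :
    ∃ g : ℝ → ℝ, Continuous g ∧ ∀ t ∈ Icc a b, g (X t) = Y t := by
  have hclosed : IsClosed (X '' Icc a b) := (isCompact_Icc.image hX).isClosed
  let f : C(Icc a b, X '' Icc a b) := ⟨fun t => ⟨X t, t, t.2, rfl⟩, by fun_prop⟩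
  have hf : IsQuotientMap f := by
    refine f.continuous.isClosedMap.isQuotientMap f.continuous ?_
    rintro ⟨_, t, ht, rfl⟩
    exact ⟨⟨t, ht⟩, rfl⟩
  let y : C(Icc a b, ℝ) := ⟨fun t => Y t, by fun_prop⟩
  have hfactor : Function.FactorsThrough y f := fun s t hst =>
    h s s.2 t t.2 (congrArg Subtype.val hst)
  obtain ⟨g, hg⟩ := ContinuousMap.exists_restrict_eq hclosed (hf.lift y hfactor)
  exact ⟨g, g.continuous, fun t ht => (DFunLike.congr_fun hg ⟨X t, t, ht, rfl⟩).trans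
    (DFunLike.congr_fun (hf.lift_comp y hfactor) ⟨t, ht⟩)⟩

lemma le_supportPt_one (hK : IsLamConvexBody lam K) {θ : ℝ} (hθ : θ ∈ Icc 0 π) {q : Plane}
    (hq : q ∈ K) (hx : q 0 = supportPt K θ 0) : q 1 ≤ supportPt K θ 1 := by
  by_contra! hlt
  have hsin := sin_nonneg_of_mem_Icc hθ
  have hsupp := (isSupportPt_supportPt hK.toIsPlanarConvexBody θ).of_inner_le hq (by
    rw [inner_dir, inner_dir, hx]
    gcongr)
  exact hlt.ne' (congr($(hsupp.eq_supportPt hK) 1))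

lemma supportPt_one_le (hK : IsLamConvexBody lam K) {θ : ℝ} (hθ : θ ∈ Icc π (2 * π)) {q : Plane}
    (hq : q ∈ K) (hx : q 0 = supportPt K θ 0) : supportPt K θ 1 ≤ q 1 := by
  by_contra! hlt
  have hsin : sin θ ≤ 0 := by
    rw [← neg_nonneg, ← sin_sub_pi]
    exact sin_nonneg_of_mem_Icc ⟨by linarith [hθ.1], by linarith [hθ.2]⟩
  have hsupp := (isSupportPt_supportPt hK.toIsPlanarConvexBody θ).of_inner_le hq (by
    rw [inner_dir, inner_dir, hx]
    linarith [mul_le_mul_of_nonpos_left hlt.le hsin])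
  exact hlt.ne (congr($(hsupp.eq_supportPt hK) 1))

lemma slice_eq_Icc (hK : IsLamConvexBody lam K) {θ φ x : ℝ} (hθ : θ ∈ Icc 0 π)
    (hφ : φ ∈ Icc π (2 * π)) (hx : supportPt K θ 0 = x) (hx' : supportPt K φ 0 = x) :
    {y : ℝ | !₂[x, y] ∈ K} = Icc (supportPt K φ 1) (supportPt K θ 1) := by
  refine Subset.antisymm (fun y hy => ⟨supportPt_one_le hK hφ hy hx'.symm,
    le_supportPt_one hK hθ hy hx.symm⟩) fun y hy => ?_
  have hspec := isSupportPt_supportPt hK.toIsPlanarConvexBody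
  rw [← segment_eq_Icc (hy.1.trans hy.2)] at hy
  obtain ⟨u, v, hu, hv, huv, rfl⟩ := hy
  refine mem_of_eq_of_mem (s := K) ?_ (hK.convex (hspec φ).1 (hspec θ).1 hu hv huv)
  ext i
  fin_cases i
  · simp [hx, hx', ← add_mul, huv]
  · simp

lemma slice_eq_empty (hK : IsPlanarConvexBody K) {x : ℝ}
    (hx : x ∉ Icc (supportPt K π 0) (supportPt K 0 0)) : {y : ℝ | !₂[x, y] ∈ K} = ∅ := by
  refine eq_empty_of_forall_notMem fun y hy => hx ?_
  have hright := (isSupportPt_supportPt hK 0).2 _ hy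
  have hleft := (isSupportPt_supportPt hK π).2 _ hy
  simp only [inner_dir, cos_zero, sin_zero, cos_pi, sin_pi] at hright hleft
  norm_num at hright hleft
  exact ⟨hleft, hright⟩

lemma planarArea_eq_integral_sub (hK : IsLamConvexBody lam K) {f g : ℝ → ℝ} (hf : Continuous f)
    (hg : Continuous g) (hgX : ∀ t ∈ Icc 0 π, g (supportPt K t 0) = supportPt K t 1)
    (hfX : ∀ t ∈ Icc π (2 * π), f (supportPt K t 0) = supportPt K t 1) :
    planarArea K = ∫ x in supportPt K π 0..supportPt K 0 0, (g x - f x) := by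
  have hspec := isSupportPt_supportPt hK.toIsPlanarConvexBody
  have hcont : Continuous fun t => supportPt K t 0 := by
    have := continuous_supportPt hK
    fun_prop
  have hle : supportPt K π 0 ≤ supportPt K 0 0 := by
    simpa [inner_dir] using (hspec 0).2 _ (hspec π).1
  have hslice {x} (hx : x ∈ Icc (supportPt K π 0) (supportPt K 0 0)) :
      {y : ℝ | !₂[x, y] ∈ K} = Icc (f x) (g x) ∧ f x ≤ g x := by
    obtain ⟨θ, hθ, hθx : supportPt K θ 0 = x⟩ :=
      intermediate_value_Icc' pi_pos.le hcont.continuousOn hx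
    rw [← (supportPt_periodic K).eq] at hx
    obtain ⟨φ, hφ, hφx : supportPt K φ 0 = x⟩ :=
      intermediate_value_Icc (by linarith [pi_pos]) hcont.continuousOn hx
    have hgx : g x = supportPt K θ 1 := hθx ▸ hgX θ hθ
    have hfx : f x = supportPt K φ 1 := hφx ▸ hfX φ hφ
    rw [hgx, hfx]
    exact ⟨slice_eq_Icc hK hθ hφ hθx hφx, le_supportPt_one hK hθ (hspec φ).1 (hφx.trans hθx.symm)⟩
  have hvolume : volume K
      = ∫⁻ x in Icc (supportPt K π 0) (supportPt K 0 0), ENNReal.ofReal (g x - f x) := by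
    rw [volume_eq_lintegral_slice hK.isCompact.measurableSet,
      ← lintegral_indicator measurableSet_Icc]
    refine lintegral_congr fun x => ?_
    by_cases hx : x ∈ Icc (supportPt K π 0) (supportPt K 0 0)
    · rw [indicator_of_mem hx, (hslice hx).1, Real.volume_Icc]
    · rw [indicator_of_notMem hx, slice_eq_empty hK.toIsPlanarConvexBody hx, measure_empty]
  rw [planarArea, hvolume, intervalIntegral.integral_of_le hle, ← integral_Icc_eq_integral_Ioc,
    integral_eq_lintegral_of_nonneg_ae ?_ (by fun_prop)]
  exact (ae_restrict_iff' measurableSet_Icc).2 <|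
    .of_forall fun x hx => sub_nonneg.2 (hslice hx).2

lemma exists_lipschitzWith_supportPt_apply (hlam : 0 < lam) (hK : IsLamConvexBody lam K)
    (i : Fin 2) : ∃ C, LipschitzWith C fun t => supportPt K t i :=
  ⟨_, (EuclideanSpace.proj i : Plane →L[ℝ] ℝ).lipschitz.comp
    (lipschitzWith_supportPt hlam hK)⟩

lemma ae_hasDerivAt_supportPt_apply (hlam : 0 < lam) (hK : IsLamConvexBody lam K) (i : Fin 2) :
    ∀ᵐ t, HasDerivAt (fun t => supportPt K t i)
      (1 / lam * density lam K t * dir (t + π / 2) i) t := by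
  filter_upwards [ae_hasDerivAt_supportPt hlam hK] with t ht
  exact (EuclideanSpace.proj i : Plane →L[ℝ] ℝ).hasFDerivAt.comp_hasDerivAt t ht

lemma planarArea_eq_neg_integral (hlam : 0 < lam) (hK : IsLamConvexBody lam K) :
    planarArea K = -∫ t in 0..2 * π,
      supportPt K t 1 * (1 / lam * density lam K t * dir (t + π / 2) 0) := by
  have hspec t := (isSupportPt_supportPt hK.toIsPlanarConvexBody t).1
  have hcont := continuous_supportPt hK
  obtain ⟨g, hg, hgX⟩ := exists_continuous_comp_eq (X := fun t => supportPt K t 0)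
    (Y := fun t => supportPt K t 1) (a := 0) (b := π) (by fun_prop) (by fun_prop)
    fun s hs t ht hst => le_antisymm (le_supportPt_one hK ht (hspec s) hst)
      (le_supportPt_one hK hs (hspec t) hst.symm)
  obtain ⟨f, hf, hfX⟩ := exists_continuous_comp_eq (X := fun t => supportPt K t 0)
    (Y := fun t => supportPt K t 1) (a := π) (b := 2 * π) (by fun_prop) (by fun_prop)
    fun s hs t ht hst => le_antisymm (supportPt_one_le hK hs (hspec t) hst.symm)
      (supportPt_one_le hK ht (hspec s) hst)
  obtain ⟨C, hC⟩ := exists_lipschitzWith_supportPt_apply hlam hK 0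
  have hderiv := ae_hasDerivAt_supportPt_apply hlam hK 0
  have hupper := integral_comp_mul_of_lipschitzWith hC hderiv hg 0 π
  have hlower := integral_comp_mul_of_lipschitzWith hC hderiv hf π (2 * π)
  rw [(supportPt_periodic K).eq] at hlower
  have hint a b : IntervalIntegrable
      (fun t => supportPt K t 1 * (1 / lam * density lam K t * dir (t + π / 2) 0)) volume a b := by
    refine ((isUnitDensity_density hlam hK).intervalIntegrable_mul
      (g := fun t => 1 / lam * supportPt K t 1 * dir (t + π / 2) 0) (by fun_prop) a b).congr ?_
    exact fun t _ => by ring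
  have hpi := pi_pos
  rw [planarArea_eq_integral_sub hK hf hg hgX hfX, intervalIntegral.integral_sub
    (hg.intervalIntegrable _ _) (hf.intervalIntegrable _ _), intervalIntegral.integral_symm,
    ← hupper, ← hlower, ← intervalIntegral.integral_add_adjacent_intervals (hint 0 π)
    (hint π (2 * π)), neg_add, sub_eq_add_neg]
  congr 2
  · refine intervalIntegral.integral_congr fun t ht => ?_
    rw [uIcc_of_le hpi.le] at ht
    simp only [hgX t ht]
  · refine intervalIntegral.integral_congr fun t ht => ?_
    rw [uIcc_of_le (by linarith)] at ht
    simp only [hfX t ht]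

lemma planarArea_eq_integral_supportFn (hlam : 0 < lam) (hK : IsLamConvexBody lam K) :
    planarArea K = 1 / 2 * (1 / lam * ∫ t in 0..2 * π, density lam K t * supportFn K t) := by
  have hcont := continuous_supportPt hK
  obtain ⟨C, hC⟩ := exists_lipschitzWith_supportPt_apply hlam hK 0
  obtain ⟨D, hD⟩ := exists_lipschitzWith_supportPt_apply hlam hK 1
  have hclosed := intervalIntegral_eq_sub_of_ae_hasDerivAt (a := 0) (b := 2 * π)
    (hC.lipschitzOnWith.absolutelyContinuousOnInterval.fun_mul
      hD.lipschitzOnWith.absolutelyContinuousOnInterval)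
    (((ae_hasDerivAt_supportPt_apply hlam hK 0).and
      (ae_hasDerivAt_supportPt_apply hlam hK 1)).mono fun _ h => h.1.mul h.2)
  have hint (i j : Fin 2) : IntervalIntegrable
      (fun t => supportPt K t i * (1 / lam * density lam K t * dir (t + π / 2) j))
      volume 0 (2 * π) := by
    refine ((isUnitDensity_density hlam hK).intervalIntegrable_mul
      (g := fun t => 1 / lam * supportPt K t i * dir (t + π / 2) j) (by fun_prop) _ _).congr ?_
    exact fun t _ => by ring
  have hsum : 1 / lam * ∫ t in 0..2 * π, density lam K t * supportFn K t
      = (∫ t in 0..2 * π, supportPt K t 0 * (1 / lam * density lam K t * dir (t + π / 2) 1))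
        - ∫ t in 0..2 * π, supportPt K t 1 * (1 / lam * density lam K t * dir (t + π / 2) 0) := by
    rw [← intervalIntegral.integral_sub (hint 0 1) (hint 1 0),
      ← intervalIntegral.integral_const_mul]
    congr! 2
    rw [supportFn, inner_dir, dir_apply_zero, dir_apply_one, cos_add_pi_div_two,
      sin_add_pi_div_two]
    ring
  have hparts : (∫ t in 0..2 * π, supportPt K t 0 * (1 / lam * density lam K t * dir (t + π / 2) 1))
      = -∫ t in 0..2 * π, supportPt K t 1 * (1 / lam * density lam K t * dir (t + π / 2) 0) := by
    rw [(supportPt_periodic K).eq, sub_self] at hclosed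
    rw [eq_neg_iff_add_eq_zero, ← intervalIntegral.integral_add (hint 0 1) (hint 1 0), ← hclosed]
    congr! 2
    ring
  rw [hsum, hparts, planarArea_eq_neg_integral hlam hK]
  ring

lemma exists_integral_density_mul_inner (hlam : 0 < lam) (hK : IsLamConvexBody lam K)
    (v : Plane) : ∃ w : Plane, ⟪w, v⟫_ℝ = 0 ∧ ∀ a b,
      1 / lam * ∫ t in a..b, density lam K t * ⟪dir t, v⟫_ℝ
        = ⟪w, supportPt K b - supportPt K a⟫_ℝ := by
  obtain ⟨α, hα⟩ := exists_eq_norm_smul_dir v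
  refine ⟨‖v‖ • dir (α + π / 2), ?_, fun a b => ?_⟩
  · conv_lhs => rw [hα]
    simp [inner_smul_left, inner_smul_right, inner_dir_dir, -dir_add_pi]
  · rw [real_inner_smul_left, inner_dir_supportPt_sub hlam hK, mul_left_comm]
    congr 1
    rw [← intervalIntegral.integral_const_mul]
    refine intervalIntegral.integral_congr fun t _ => ?_
    conv_lhs => rw [hα, inner_smul_right, inner_dir_dir]
    rw [add_sub_right_comm, sin_add_pi_div_two, ← cos_neg (α - t), neg_sub]
    ring

lemma integral_density_mul_supportFn (hlam : 0 < lam) (hK : IsLamConvexBody lam K) (a b : ℝ) :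
    ∫ t in a..b, density lam K t * supportFn K t
      = (∫ t in a..b, density lam K t * ⟪dir t, supportPt K a⟫_ℝ)
        + 1 / lam * triangleIntegral (density lam K) a b fun s t => sin (t - s) := by
  have hρ := isUnitDensity_density hlam hK
  have hinner : Continuous fun t => ∫ s in a..t, density lam K s * sin (t - s) :=
    hρ.continuous_integral_mul (g := fun s t => sin (t - s)) (by fun_prop) a
  rw [triangleIntegral, ← intervalIntegral.integral_const_mul, ← intervalIntegral.integral_add
    (hρ.intervalIntegrable_mul (by fun_prop) a b)
    ((hρ.intervalIntegrable_mul hinner a b).const_mul _)]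
  congr! 2 with t
  rw [supportFn_eq hlam hK a t]
  ring

lemma integral_density_mul_inner_add_eq_zero (hlam : 0 < lam) (hK : IsLamConvexBody lam K)
    {a b c : ℝ} (hac : supportPt K c = supportPt K a) :
    (∫ t in a..b, density lam K t * ⟪dir t, supportPt K a⟫_ℝ)
      + ∫ t in b..c, density lam K t * ⟪dir t, supportPt K b⟫_ℝ = 0 := by
  have hint (v : Plane) (a b) :
      IntervalIntegrable (fun t => density lam K t * ⟪dir t, v⟫_ℝ) volume a b :=
    (isUnitDensity_density hlam hK).intervalIntegrable_mul (by fun_prop) a b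
  have hr : 1 / lam ≠ 0 := by positivity
  have hround : ∫ t in a..c, density lam K t * ⟪dir t, supportPt K a⟫_ℝ = 0 := by
    obtain ⟨w, -, hw⟩ := exists_integral_density_mul_inner hlam hK (supportPt K a)
    simpa [hac, hlam.ne'] using hw a c
  have hchord : ∫ t in b..c, density lam K t * ⟪dir t, supportPt K c - supportPt K b⟫_ℝ = 0 := by
    obtain ⟨w, hw, hint⟩ := exists_integral_density_mul_inner hlam hK
      (supportPt K c - supportPt K b)
    exact (mul_eq_zero.1 ((hint b c).trans hw)).resolve_left hr
  simp only [inner_sub_right, mul_sub, hac] at hchord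
  rw [intervalIntegral.integral_sub (hint _ b c) (hint _ b c), sub_eq_zero] at hchord
  rw [← hchord, intervalIntegral.integral_add_adjacent_intervals (hint _ a b) (hint _ b c), hround]

lemma planarArea_eq_integral_add_two_pi (hlam : 0 < lam) (hK : IsLamConvexBody lam K) (p : ℝ) :
    planarArea K = 1 / 2 * (1 / lam * ∫ t in p..p + 2 * π, density lam K t * supportFn K t) := by
  have hperiodic : Function.Periodic (fun t => density lam K t * supportFn K t) (2 * π) :=
    (density_periodic lam K).mul fun t => by
      rw [supportFn, supportFn, supportPt_periodic, dir_periodic]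
  rw [planarArea_eq_integral_supportFn hlam hK, ← hperiodic.intervalIntegral_add_eq 0 p, zero_add]

theorem planarArea_eq_triangleIntegral (hlam : 0 < lam) (hK : IsLamConvexBody lam K) (p : ℝ) :
    planarArea K = 1 / 2 * (1 / lam) ^ 2 *
      (triangleIntegral (density lam K) p (p + π) (fun s t => sin (t - s))
        + triangleIntegral (density lam K) (p + π) (p + π + π) fun s t => sin (t - s)) := by
  have hint := (isUnitDensity_density hlam hK).intervalIntegrable_mul (continuous_supportFn hK)
  have htwo : p + 2 * π = p + π + π := by ring
  have hclosed : supportPt K (p + π + π) = supportPt K p := by rw [← htwo, supportPt_periodic]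
  rw [planarArea_eq_integral_add_two_pi hlam hK p, htwo,
    ← intervalIntegral.integral_add_adjacent_intervals (hint p (p + π)) (hint _ _),
    integral_density_mul_supportFn hlam hK p, integral_density_mul_supportFn hlam hK (p + π)]
  linear_combination 1 / 2 * (1 / lam) *
    integral_density_mul_inner_add_eq_zero hlam hK (b := p + π) hclosed

end Area

section CentralArcsAndGaps

variable {ρ : ℝ → ℝ} {a b c d x y : ℝ}

lemma cos_add_cos_sub_one_add_cos_add (x y : ℝ) :
    cos x + cos y - (1 + cos (x + y)) = 4 * (sin (x / 2) * sin (y / 2) * cos ((x + y) / 2)) := by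
  obtain ⟨x, rfl⟩ : ∃ z, x = 2 * z := ⟨x / 2, by ring⟩
  obtain ⟨y, rfl⟩ : ∃ z, y = 2 * z := ⟨y / 2, by ring⟩
  rw [← mul_add, mul_div_cancel_left₀ _ two_ne_zero, mul_div_cancel_left₀ _ two_ne_zero,
    mul_div_cancel_left₀ _ two_ne_zero, cos_two_mul x, cos_two_mul y, cos_two_mul (x + y), cos_add]
  linear_combination 2 * sin y ^ 2 * sin_sq_add_cos_sq x
    + 2 * (1 - cos x ^ 2) * sin_sq_add_cos_sq y

lemma one_add_cos_add_le (hx : 0 ≤ x) (hy : 0 ≤ y) (hxy : x + y ≤ π) :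
    1 + cos (x + y) ≤ cos x + cos y := by
  rw [← sub_nonneg, cos_add_cos_sub_one_add_cos_add]
  have := sin_nonneg_of_nonneg_of_le_pi (x := x / 2) (by linarith) (by linarith)
  have := sin_nonneg_of_nonneg_of_le_pi (x := y / 2) (by linarith) (by linarith)
  have := cos_nonneg_of_mem_Icc (x := (x + y) / 2) ⟨by linarith, by linarith⟩
  positivity

lemma one_add_cos_add_lt (hx : 0 < x) (hy : 0 < y) (hxy : x + y < π) :
    1 + cos (x + y) < cos x + cos y := by
  rw [← sub_pos, cos_add_cos_sub_one_add_cos_add]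
  have := sin_pos_of_pos_of_lt_pi (x := x / 2) (by linarith) (by linarith)
  have := sin_pos_of_pos_of_lt_pi (x := y / 2) (by linarith) (by linarith)
  have := cos_pos_of_mem_Ioo (x := (x + y) / 2) ⟨by linarith, by linarith⟩
  positivity

namespace IsUnitDensity

lemma one_sub (h : IsUnitDensity ρ) : IsUnitDensity fun t => 1 - ρ t where
  measurable := h.measurable.const_sub 1
  nonneg t := sub_nonneg.2 (h.le_one t)
  le_one t := sub_le_self 1 (h.nonneg t)

lemma mass_one_sub (h : IsUnitDensity ρ) (a b : ℝ) :
    mass (fun t => 1 - ρ t) a b = b - a - mass ρ a b := by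
  simp [mass, intervalIntegral.integral_sub intervalIntegrable_const (h.intervalIntegrable a b)]

lemma mass_eq_zero_of_subset (h : IsUnitDensity ρ) (h0 : mass ρ a b = 0) (hac : a ≤ c) (hcd : c ≤ d)
    (hdb : d ≤ b) : mass ρ c d = 0 := by
  have := h.mass_nonneg hac
  have := h.mass_nonneg hcd
  have := h.mass_nonneg hdb
  linarith [h.mass_add_mass a c b, h.mass_add_mass c d b]

lemma mass_eq_sub_of_subset (h : IsUnitDensity ρ) (h1 : mass ρ a b = b - a) (hac : a ≤ c)
    (hcd : c ≤ d) (hdb : d ≤ b) : mass ρ c d = d - c := by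
  have := h.one_sub.mass_eq_zero_of_subset (by rw [h.mass_one_sub, h1, sub_self]) hac hcd hdb
  linarith [h.mass_one_sub c d]

lemma integral_mul_eq_zero (h : IsUnitDensity ρ) (h0 : mass ρ a b = 0) (g : ℝ → ℝ) :
    ∫ s in a..b, ρ s * g s = 0 := by
  have hzero := (intervalIntegral.integral_eq_zero_iff_of_nonneg_ae (ae_of_all _ h.nonneg)
    (h.intervalIntegrable a b)).1 h0
  refine intervalIntegral.integral_zero_ae ?_
  rw [← ae_restrict_iff' measurableSet_uIoc, uIoc_eq_union]
  filter_upwards [hzero] with s hs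
  rw [hs, Pi.zero_apply, zero_mul]

lemma integral_mul_eq (h : IsUnitDensity ρ) (h1 : mass ρ a b = b - a) {g : ℝ → ℝ}
    (hg : Continuous g) : ∫ s in a..b, ρ s * g s = ∫ s in a..b, g s := by
  have hcompl := h.one_sub.integral_mul_eq_zero (by rw [h.mass_one_sub, h1, sub_self]) g
  simp only [sub_mul, one_mul] at hcompl
  rw [intervalIntegral.integral_sub (hg.intervalIntegrable a b) (h.intervalIntegrable_mul hg a b)]
    at hcompl
  linarith

lemma integral_mul_split (h : IsUnitDensity ρ) {g : ℝ → ℝ} (hg : Continuous g) (a c d b : ℝ) :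
    ∫ s in a..b, ρ s * g s = (∫ s in a..c, ρ s * g s) + (∫ s in c..d, ρ s * g s)
      + ∫ s in d..b, ρ s * g s := by
  rw [intervalIntegral.integral_add_adjacent_intervals (h.intervalIntegrable_mul hg _ _)
    (h.intervalIntegrable_mul hg _ _), intervalIntegral.integral_add_adjacent_intervals
    (h.intervalIntegrable_mul hg _ _) (h.intervalIntegrable_mul hg _ _)]

lemma one_sub_cos_mass_le_of_hasCentralArc (h : IsUnitDensity ρ)
    (harc : HasCentralArc ρ a (a + π)) :
    1 - cos (mass ρ a (a + π)) ≤ ∫ s in a..a + π, ρ s * sin (s - a) := by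
  obtain ⟨c, d, hac, hcd, hdb, hmac, hmcd, hmdb⟩ := harc
  have hmass : mass ρ a (a + π) = d - c := by
    linarith [h.mass_add_mass a c (a + π), h.mass_add_mass c d (a + π)]
  rw [h.integral_mul_split (g := fun s => sin (s - a)) (by fun_prop) a c d,
    h.integral_mul_eq_zero hmac, h.integral_mul_eq_zero hmdb, h.integral_mul_eq hmcd (by fun_prop),
    intervalIntegral.integral_comp_sub_right, integral_sin, hmass]
  have := one_add_cos_add_le (x := c - a) (y := d - c) (by linarith) (by linarith) (by linarith)
  rw [sub_add_sub_cancel'] at this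
  linarith

/-- With the same mass, two arcs at the ends of a half turn contribute less width than a single one,
unless they form a single arc. -/
lemma hasCentralArc_of_hasCentralGap (h : IsUnitDensity ρ) (hgap : HasCentralGap ρ a (a + π))
    (hle : 1 - cos (mass ρ a (a + π)) ≤ ∫ s in a..a + π, ρ s * sin (s - a)) :
    HasCentralArc ρ a (a + π) := by
  obtain ⟨c, d, hac, hcd, hdb, hmac, hmcd, hmdb⟩ := hgap
  have hadd := h.mass_add_mass
  rcases hac.eq_or_lt with rfl | hac
  · exact ⟨d, a + π, hcd, hdb, le_rfl, hmcd, hmdb, mass_self _ _⟩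
  rcases hdb.eq_or_lt with rfl | hdb
  · exact ⟨a, c, le_rfl, hac.le, hcd, mass_self _ _, hmac, hmcd⟩
  rcases hcd.eq_or_lt with rfl | hcd
  · exact ⟨a, a + π, le_rfl, by linarith, le_rfl, mass_self _ _, by linarith [hadd a c (a + π)],
      mass_self _ _⟩
  have hmass : mass ρ a (a + π) = c - a + (a + π - d) := by
    linarith [hadd a c (a + π), hadd c d (a + π)]
  rw [h.integral_mul_split (g := fun s => sin (s - a)) (by fun_prop) a c d,
    h.integral_mul_eq_zero hmcd, h.integral_mul_eq hmac (by fun_prop),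
    h.integral_mul_eq hmdb (by fun_prop), intervalIntegral.integral_comp_sub_right,
    intervalIntegral.integral_comp_sub_right, integral_sin, integral_sin, hmass] at hle
  have hlt := one_add_cos_add_lt (x := c - a) (y := a + π - d) (by linarith) (by linarith)
    (by linarith)
  have hcos : cos (a + π - d) = -cos (d - a) := by
    rw [show a + π - d = π - (d - a) by ring, cos_pi_sub]
  rw [sub_self, cos_zero, add_sub_cancel_left, cos_pi] at hle
  linarith

end IsUnitDensity

end CentralArcsAndGaps

section Equality

variable {K : Set Plane} {lam a b c d p t φ : ℝ} {z : Plane}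

lemma ext_inner_dir {p q : Plane} (h : ∀ φ, ⟪dir φ, p⟫_ℝ = ⟪dir φ, q⟫_ℝ) : p = q := by
  rw [eq_inner_dir_smul_add 0 p, h, h, ← eq_inner_dir_smul_add]

lemma supportPt_eq_of_mass_eq_zero (hlam : 0 < lam) (hK : IsLamConvexBody lam K)
    (h0 : mass (density lam K) a b = 0) : supportPt K b = supportPt K a :=
  ext_inner_dir fun φ => by
    rw [← sub_eq_zero, ← inner_sub_right, inner_dir_supportPt_sub hlam hK,
      (isUnitDensity_density hlam hK).integral_mul_eq_zero h0, mul_zero]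

lemma supportPt_sub_smul_dir_eq (hlam : 0 < lam) (hK : IsLamConvexBody lam K)
    (h1 : mass (density lam K) a b = b - a) :
    supportPt K b - (1 / lam) • dir b = supportPt K a - (1 / lam) • dir a := by
  rw [sub_eq_sub_iff_sub_eq_sub]
  refine ext_inner_dir fun φ => ?_
  rw [inner_dir_supportPt_sub hlam hK, (isUnitDensity_density hlam hK).integral_mul_eq h1
    (by fun_prop), intervalIntegral.integral_comp_sub_left, integral_sin, ← smul_sub,
    inner_smul_right, inner_sub_right, inner_dir_dir, inner_dir_dir]

lemma supportFn_le_inner_add_of_abs_le_pi (hlam : 0 < lam) (hK : IsLamConvexBody lam K)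
    (hab : |b - a| ≤ π) :
    supportFn K b ≤ ⟪dir b, supportPt K a⟫_ℝ + 1 / lam * (1 - cos (b - a)) := by
  have hclosed : IsClosed {x | supportFn K x ≤ ⟪dir x, supportPt K a⟫_ℝ
      + 1 / lam * (1 - cos (x - a))} :=
    isClosed_le (continuous_supportFn hK) (by fun_prop)
  have hsub := closure_minimal (fun x hx => supportFn_le_inner_add hlam hK hx) hclosed
    (s := ball a π)
  rw [closure_ball a pi_pos.ne'] at hsub
  exact hsub hab

lemma exists_abs_sub_le_dir_eq (a φ : ℝ) : ∃ b, |b - a| ≤ π ∧ dir b = dir φ := by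
  obtain ⟨b, hb, hdir⟩ := dir_periodic.exists_mem_Ico two_pi_pos φ (a - π)
  exact ⟨b, abs_le.2 ⟨by linarith [hb.1], by linarith [hb.2]⟩, hdir.symm⟩

/-- The disc of radius `1 / lam` internally tangent to the boundary of `K` at the point with outer
normal angle `θ`. -/
def tangentDisc (lam : ℝ) (K : Set Plane) (θ : ℝ) : Set Plane :=
  closedBall (supportPt K θ - (1 / lam) • dir θ) (1 / lam)

/-- Blaschke's rolling theorem: the containment is global. -/
lemma subset_tangentDisc (hlam : 0 < lam) (hK : IsLamConvexBody lam K) (θ : ℝ) :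
    K ⊆ tangentDisc lam K θ := fun q hq => by
  obtain ⟨φ, hφ⟩ := exists_eq_norm_smul_dir (q - (supportPt K θ - (1 / lam) • dir θ))
  obtain ⟨b, hb, hdir⟩ := exists_abs_sub_le_dir_eq θ φ
  have hnorm := congrArg (fun v => ⟪dir b, v⟫_ℝ) hφ
  simp only [← hdir, inner_smul_right, inner_sub_right, inner_dir_dir, sub_self, cos_zero,
    mul_one] at hnorm
  rw [tangentDisc, mem_closedBall_iff_norm, ← hnorm]
  linarith [supportFn_le_inner_add_of_abs_le_pi hlam hK hb,
    inner_dir_le_supportFn hK.toIsPlanarConvexBody hq b]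

lemma inner_dir_le_supportFn_of_mem_tangentDisc (hlam : 0 < lam) (hK : IsLamConvexBody lam K)
    (h1 : mass (density lam K) a b = b - a) (ht : t ∈ Icc a b) (hφ : φ ∈ Icc a b)
    (hz : z ∈ tangentDisc lam K t) : ⟪dir φ, z⟫_ℝ ≤ supportFn K φ := by
  have hρ := isUnitDensity_density hlam hK
  have hcenter {s} (hs : s ∈ Icc a b) := supportPt_sub_smul_dir_eq hlam hK <|
    hρ.mass_eq_sub_of_subset h1 le_rfl hs.1 hs.2
  rw [tangentDisc, hcenter ht, ← hcenter hφ] at hz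
  have := inner_dir_le_of_mem_closedBall hz φ
  rwa [inner_sub_right, inner_smul_right, inner_dir_dir, sub_self, cos_zero, mul_one,
    sub_add_cancel] at this

lemma sub_lt_pi_of_mass_eq_zero (hlam : 0 < lam) (hK : IsLamConvexBody lam K)
    (h0 : mass (density lam K) a b = 0) : b - a < π := by
  by_contra! hlong
  have hb := hK.toIsPlanarConvexBody
  refine not_isSupportPt_add_pi hb (isSupportPt_supportPt hb a) ?_
  rw [← supportPt_eq_of_mass_eq_zero hlam hK (b := a + π) <|
    (isUnitDensity_density hlam hK).mass_eq_zero_of_subset h0 le_rfl (by linarith [pi_pos])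
      (by linarith)]
  exact isSupportPt_supportPt hb _

lemma inner_dir_le_supportFn_of_mass_eq_zero (hlam : 0 < lam) (hK : IsLamConvexBody lam K)
    (h0 : mass (density lam K) a b = 0) (ha : ⟪dir a, z⟫_ℝ ≤ supportFn K a)
    (hb : ⟪dir b, z⟫_ℝ ≤ supportFn K b) (hφ : φ ∈ Icc a b) : ⟪dir φ, z⟫_ℝ ≤ supportFn K φ := by
  have hconst {t} (ht : t ∈ Icc a b) := supportPt_eq_of_mass_eq_zero hlam hK <|
    (isUnitDensity_density hlam hK).mass_eq_zero_of_subset h0 le_rfl ht.1 ht.2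
  rw [supportFn, hconst ⟨hφ.1.trans hφ.2, le_rfl⟩] at hb
  rw [supportFn, hconst hφ]
  exact inner_dir_le_of_mem_Icc ha hb hφ (sub_lt_pi_of_mass_eq_zero hlam hK h0)

lemma isLamConvexLens_of_mass (hlam : 0 < lam) (hK : IsLamConvexBody lam K) (hbc : b ≤ c)
    (hda : d ≤ a + 2 * π) (hab0 : mass (density lam K) a b = 0)
    (hbc1 : mass (density lam K) b c = c - b) (hcd0 : mass (density lam K) c d = 0)
    (hda1 : mass (density lam K) d (a + 2 * π) = a + 2 * π - d) : IsLamConvexLens lam K := by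
  refine ⟨hK.interior_nonempty, _, _, Subset.antisymm
    (subset_inter (subset_tangentDisc hlam hK b) (subset_tangentDisc hlam hK d)) ?_⟩
  rintro z ⟨hzb, hzd⟩
  have hbcz {φ} (hφ : φ ∈ Icc b c) : ⟪dir φ, z⟫_ℝ ≤ supportFn K φ :=
    inner_dir_le_supportFn_of_mem_tangentDisc hlam hK hbc1 ⟨le_rfl, hbc⟩ hφ hzb
  have hdaz {φ} (hφ : φ ∈ Icc d (a + 2 * π)) : ⟪dir φ, z⟫_ℝ ≤ supportFn K φ :=
    inner_dir_le_supportFn_of_mem_tangentDisc hlam hK hda1 ⟨le_rfl, hda⟩ hφ hzd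
  have haz : ⟪dir a, z⟫_ℝ ≤ supportFn K a := by
    simpa only [supportFn, supportPt_periodic K a, dir_periodic a] using hdaz ⟨hda, le_rfl⟩
  refine mem_of_forall_inner_dir_le hK.toIsPlanarConvexBody fun θ => ?_
  obtain ⟨φ, hφ, hdir⟩ := dir_periodic.exists_mem_Ico two_pi_pos θ a
  rw [supportFn, supportPt_congr hdir, hdir, ← supportFn]
  rcases le_total φ b with hφb | hbφ
  · exact inner_dir_le_supportFn_of_mass_eq_zero hlam hK hab0 haz (hbcz ⟨le_rfl, hbc⟩) ⟨hφ.1, hφb⟩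
  rcases le_total φ c with hφc | hcφ
  · exact hbcz ⟨hbφ, hφc⟩
  rcases le_total φ d with hφd | hdφ
  · exact inner_dir_le_supportFn_of_mass_eq_zero hlam hK hcd0 (hbcz ⟨hbc, le_rfl⟩)
      (hdaz ⟨le_rfl, hda⟩) ⟨hcφ, hφd⟩
  · exact hdaz ⟨hdφ, hφ.2.le⟩

lemma mass_density_add_two_pi (lam : ℝ) (K : Set Plane) (a b : ℝ) :
    mass (density lam K) (a + 2 * π) (b + 2 * π) = mass (density lam K) a b := by
  rw [mass, ← intervalIntegral.integral_comp_add_right]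
  simp only [density_periodic lam K _, mass]

lemma isLamConvexLens_of_hasCentralArc (hlam : 0 < lam) (hK : IsLamConvexBody lam K)
    (h₁ : HasCentralArc (density lam K) p (p + π))
    (h₂ : HasCentralArc (density lam K) (p + π) (p + π + π)) : IsLamConvexLens lam K := by
  obtain ⟨c₁, d₁, -, hcd₁, -, hmpc₁, hmcd₁, hmdp₁⟩ := h₁
  obtain ⟨c₂, d₂, -, hcd₂, -, hmpc₂, hmcd₂, hmdp₂⟩ := h₂
  have hadd := (isUnitDensity_density hlam hK).mass_add_mass
  have hshift := mass_density_add_two_pi lam K (d₂ - 2 * π) p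
  have htwo : p + 2 * π = p + π + π := by ring
  rw [sub_add_cancel, htwo, hmdp₂] at hshift
  refine isLamConvexLens_of_mass hlam hK (a := d₂ - 2 * π) (d := c₂) hcd₁ (by linarith) ?_ hmcd₁ ?_
    (by rwa [sub_add_cancel])
  · rw [← hadd _ p, ← hshift, hmpc₁, add_zero]
  · rw [← hadd _ (p + π), hmdp₁, hmpc₂, add_zero]

lemma isLamConvexLens_of_hasCentralGap (hlam : 0 < lam) (hK : IsLamConvexBody lam K)
    (h₁ : HasCentralGap (density lam K) p (p + π))
    (h₂ : HasCentralGap (density lam K) (p + π) (p + π + π)) : IsLamConvexLens lam K := by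
  obtain ⟨c₁, d₁, hpc₁, -, hdp₁, hmpc₁, hmcd₁, hmdp₁⟩ := h₁
  obtain ⟨c₂, d₂, hpc₂, -, hdp₂, hmpc₂, hmcd₂, hmdp₂⟩ := h₂
  have hadd := (isUnitDensity_density hlam hK).mass_add_mass
  have hshift := mass_density_add_two_pi lam K p c₁
  have htwo : p + 2 * π = p + π + π := by ring
  rw [htwo, hmpc₁] at hshift
  exact isLamConvexLens_of_mass hlam hK (hdp₁.trans hpc₂) (by linarith) hmcd₁
    (by linarith [hadd d₁ (p + π) c₂]) hmcd₂
    (by linarith [hadd d₂ (p + π + π) (c₁ + 2 * π)])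

lemma integral_density_mul_sin_eq (hlam : 0 < lam) (hK : IsLamConvexBody lam K) (p : ℝ) :
    ∫ s in p..p + π, density lam K s * sin (s - p)
      = ∫ s in p + π..p + π + π, density lam K s * sin (s - (p + π)) := by
  have hwidth₁ := inner_dir_supportPt_sub hlam hK p (p + π) p
  have hwidth₂ := inner_dir_supportPt_sub hlam hK p (p + π) (p + π + π)
  rw [add_assoc p π π, ← two_mul, supportPt_periodic, hwidth₁, intervalIntegral.integral_symm,
    mul_right_inj' (by positivity), ← intervalIntegral.integral_neg] at hwidth₂
  rw [add_assoc p π π, ← two_mul]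
  convert hwidth₂ using 3 with s s
  · rw [← neg_sub p s, sin_neg, mul_neg]
  · rw [← neg_sub (p + π) s, sin_neg, add_sub_right_comm, sin_add_pi, neg_neg]

lemma isLamConvexLens_of_halves (hlam : 0 < lam) (hK : IsLamConvexBody lam K)
    (hmass : mass (density lam K) p (p + π) = mass (density lam K) (p + π) (p + π + π))
    (h₁ : HasCentralArc (density lam K) p (p + π) ∨ HasCentralGap (density lam K) p (p + π))
    (h₂ : HasCentralArc (density lam K) (p + π) (p + π + π) ∨
      HasCentralGap (density lam K) (p + π) (p + π + π)) : IsLamConvexLens lam K := by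
  have hρ := isUnitDensity_density hlam hK
  have hwidth := integral_density_mul_sin_eq hlam hK p
  rcases h₁ with harc₁ | hgap₁ <;> rcases h₂ with harc₂ | hgap₂
  · exact isLamConvexLens_of_hasCentralArc hlam hK harc₁ harc₂
  · refine isLamConvexLens_of_hasCentralArc hlam hK harc₁
      (hρ.hasCentralArc_of_hasCentralGap hgap₂ ?_)
    rw [← hmass, ← hwidth]
    exact hρ.one_sub_cos_mass_le_of_hasCentralArc harc₁
  · refine isLamConvexLens_of_hasCentralArc hlam hK
      (hρ.hasCentralArc_of_hasCentralGap hgap₁ ?_) harc₂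
    rw [hmass, hwidth]
    exact hρ.one_sub_cos_mass_le_of_hasCentralArc harc₂
  · exact isLamConvexLens_of_hasCentralGap hlam hK hgap₁ hgap₂

end Equality

section Inequality

variable {K : Set Plane} {lam : ℝ}

lemma mass_add_mass_add_pi (hlam : 0 < lam) (hK : IsLamConvexBody lam K) (p : ℝ) :
    mass (density lam K) p (p + π) + mass (density lam K) (p + π) (p + π + π)
      = mass (density lam K) 0 (2 * π) := by
  have hperiod := (density_periodic lam K).intervalIntegral_add_eq p 0
  rwa [zero_add, two_mul, ← add_assoc, ← mass, ← mass, ← two_mul,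
    ← (isUnitDensity_density hlam hK).mass_add_mass p (p + π)] at hperiod

/-- Advancing `p` by `π` swaps the two halves, so the intermediate value theorem balances them. -/
lemma exists_halving (hlam : 0 < lam) (hK : IsLamConvexBody lam K) :
    ∃ p, mass (density lam K) p (p + π) = mass (density lam K) 0 (2 * π) / 2 ∧
      mass (density lam K) (p + π) (p + π + π) = mass (density lam K) 0 (2 * π) / 2 := by
  have hcont : Continuous fun p => mass (density lam K) p (p + π) :=
    (isUnitDensity_density hlam hK).continuous_mass.comp (by fun_prop : Continuous fun p =>
      (p, p + π))
  have hsum := mass_add_mass_add_pi hlam hK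
  obtain ⟨p, hp⟩ : ∃ p, mass (density lam K) p (p + π) = mass (density lam K) 0 (2 * π) / 2 := by
    rcases le_total (mass (density lam K) 0 (0 + π)) (mass (density lam K) 0 (2 * π) / 2) with h | h
    · exact mem_range_of_exists_le_of_exists_ge hcont ⟨0, h⟩ ⟨0 + π, by linarith [hsum 0]⟩
    · exact mem_range_of_exists_le_of_exists_ge hcont ⟨0 + π, by linarith [hsum 0]⟩ ⟨0, h⟩
  exact ⟨p, hp, by linarith [hsum p]⟩

lemma mass_density_two_pi_pos (hlam : 0 < lam) (hK : IsLamConvexBody lam K) :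
    0 < mass (density lam K) 0 (2 * π) := by
  refine ((isUnitDensity_density hlam hK).mass_nonneg two_pi_pos.le).lt_of_ne' fun h0 => ?_
  linarith [sub_lt_pi_of_mass_eq_zero hlam hK h0, pi_pos]

/-- The area of a `lam`-convex lens with boundary length `ℓ`. -/
noncomputable def lensArea (lam ℓ : ℝ) : ℝ :=
  ℓ / (2 * lam) - 1 / lam ^ 2 * sin (ℓ * lam / 2)

lemma lensArea_boundaryLength (hlam : 0 < lam) (hK : IsLamConvexBody lam K) :
    lensArea lam (boundaryLength K) = (1 / lam) ^ 2 *
      (mass (density lam K) 0 (2 * π) / 2 - sin (mass (density lam K) 0 (2 * π) / 2)) := by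
  rw [lensArea, boundaryLength_eq hlam hK, one_div_mul_eq_div, div_mul_cancel₀ _ hlam.ne']
  field_simp

lemma lensArea_boundaryLength_le (hlam : 0 < lam) (hK : IsLamConvexBody lam K) :
    lensArea lam (boundaryLength K) ≤ planarArea K := by
  obtain ⟨p, hp₁, hp₂⟩ := exists_halving hlam hK
  have hρ := isUnitDensity_density hlam hK
  have h₁ := hρ.mass_sub_sin_mass_le p
  have h₂ := hρ.mass_sub_sin_mass_le (p + π)
  rw [hp₁] at h₁
  rw [hp₂] at h₂
  rw [lensArea_boundaryLength hlam hK, planarArea_eq_triangleIntegral hlam hK p, mul_comm (1 / 2),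
    mul_assoc]
  gcongr
  linarith

lemma isLamConvexLens_of_planarArea_eq (hlam : 0 < lam) (hK : IsLamConvexBody lam K)
    (heq : planarArea K = lensArea lam (boundaryLength K)) : IsLamConvexLens lam K := by
  obtain ⟨p, hp₁, hp₂⟩ := exists_halving hlam hK
  have hρ := isUnitDensity_density hlam hK
  have hle₁ := hρ.mass_sub_sin_mass_le p
  have hle₂ := hρ.mass_sub_sin_mass_le (p + π)
  have hpos := mass_density_two_pi_pos hlam hK
  rw [lensArea_boundaryLength hlam hK, planarArea_eq_triangleIntegral hlam hK p, mul_comm (1 / 2),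
    mul_assoc, mul_right_inj' (by positivity)] at heq
  rw [hp₁] at hle₁
  rw [hp₂] at hle₂
  refine isLamConvexLens_of_halves hlam hK (hp₁.trans hp₂.symm)
    (hρ.hasCentralArc_or_hasCentralGap_of_eq ?_ (by linarith))
    (hρ.hasCentralArc_or_hasCentralGap_of_eq ?_ (by linarith))
  · rw [hp₁]
    linarith
  · rw [hp₂]
    linarith

end Inequality

section Lenses

variable {K : Set Plane} {lam r ω η θ x y : ℝ} {a b c : Plane}

lemma density_eq_of_mem_Ioo (h : ∀ t ∈ Icc x y, supportPt K t = c + r • dir t)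
    (hθ : θ ∈ Ioo x y) : density lam K θ = lam * r := by
  have heq : supportPt K =ᶠ[𝓝 θ] fun t => c + r • dir t := by
    filter_upwards [Icc_mem_nhds hθ.1 hθ.2] using h
  rw [density, heq.deriv_eq, ((hasDerivAt_dir θ).fun_const_smul r |>.const_add c).deriv,
    inner_smul_right, inner_dir_dir, sub_self, cos_zero, mul_one]

lemma integral_density_mul_supportFn_of_eq (h : ∀ t ∈ Icc x y, supportPt K t = c + r • dir t)
    (hxy : x ≤ y) : ∫ t in x..y, density lam K t * supportFn K t
      = lam * r * ((∫ t in x..y, ⟪dir t, c⟫_ℝ) + (y - x) * r) := by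
  have hcongr : ∀ t ∈ Ioo x y,
      density lam K t * supportFn K t = lam * r * (⟪dir t, c⟫_ℝ + r) := fun t ht => by
    rw [density_eq_of_mem_Ioo h ht, supportFn, h t (Ioo_subset_Icc_self ht), inner_add_right,
      inner_smul_right, inner_dir_dir, sub_self, cos_zero, mul_one]
  rw [intervalIntegral.integral_congr_Ioo_of_le hxy hcongr, intervalIntegral.integral_const_mul,
    intervalIntegral.integral_add ((by fun_prop : Continuous _).intervalIntegrable x y)
      intervalIntegrable_const, intervalIntegral.integral_const, smul_eq_mul]

lemma mass_density_of_eq (h : ∀ t ∈ Icc x y, supportPt K t = c + r • dir t) (hxy : x ≤ y) :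
    mass (density lam K) x y = lam * r * (y - x) := by
  rw [mass, intervalIntegral.integral_congr_Ioo_of_le hxy fun t ht => density_eq_of_mem_Ioo h ht,
    intervalIntegral.integral_const, smul_eq_mul, mul_comm]

lemma dir_add_add_dir_sub (ω η : ℝ) : dir (ω + η) + dir (ω - η) = (2 * cos η) • dir ω := by
  refine ext_inner_dir fun φ => ?_
  rw [inner_add_right, inner_smul_right, inner_dir_dir, inner_dir_dir, inner_dir_dir,
    ← sub_sub, sub_sub_eq_add_sub, add_sub_right_comm, cos_sub, cos_add (φ - ω)]
  ring

lemma isSupportPt_closedBall_inter (hr : 0 ≤ r) (hab : a - b = (2 * (r * cos η)) • dir ω)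
    (hη : η ≤ π / 2) (hθ : θ ∈ Icc (ω - η) (ω + η)) :
    IsSupportPt (closedBall a r ∩ closedBall b r) θ (b + r • dir θ) := by
  have habs : |θ - ω| ≤ η := abs_le.2 ⟨by linarith [hθ.1], by linarith [hθ.2]⟩
  have hη0 : 0 ≤ cos η := cos_nonneg_of_mem_Icc ⟨by linarith [abs_nonneg (θ - ω), pi_pos], hη⟩
  have hcos : cos η ≤ cos (θ - ω) := by
    rw [← cos_abs (θ - ω)]
    exact cos_le_cos_of_nonneg_of_le_pi (abs_nonneg _) (by linarith [pi_pos]) habs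
  refine ⟨⟨?_, ?_⟩, fun q hq => ?_⟩
  · rw [mem_closedBall_iff_norm, ← pow_le_pow_iff_left₀ (norm_nonneg _) hr two_ne_zero,
      sub_eq_iff_eq_add.1 hab, add_comm _ b, add_sub_add_left_eq_sub, norm_sub_sq_real, norm_smul,
      norm_smul, norm_dir, norm_dir, inner_smul_left, inner_smul_right, inner_dir_dir]
    simp only [norm_eq_abs, conj_trivial, mul_one, sq_abs]
    nlinarith [mul_nonneg (mul_nonneg (sq_nonneg r) hη0) (sub_nonneg.2 hcos)]
  · simp [norm_smul, abs_of_nonneg hr]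
  · rw [inner_add_right, inner_smul_right, inner_dir_dir, sub_self, cos_zero, mul_one]
    exact inner_dir_le_of_mem_closedBall hq.2 θ

lemma sub_eq_smul_dir_add_pi (hab : a - b = r • dir ω) : b - a = r • dir (ω + π) := by
  rw [dir_add_pi, smul_neg, ← hab, neg_sub]

lemma isSupportPt_closedBall_inter_corner (hr : 0 ≤ r) (hab : a - b = (2 * (r * cos η)) • dir ω)
    (hη0 : 0 < η) (hη : η ≤ π / 2) (hθ : θ ∈ Icc (ω + η) (ω + π - η)) :
    IsSupportPt (closedBall a r ∩ closedBall b r) θ (b + r • dir (ω + η)) := by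
  have hcorner : a + r • dir (ω + π - η) = b + r • dir (ω + η) := by
    rw [sub_eq_iff_eq_add.1 hab, add_sub_right_comm, dir_add_pi,
      mul_left_comm, mul_smul r, ← dir_add_add_dir_sub, smul_add, smul_neg]
    abel
  have hleft := isSupportPt_closedBall_inter hr hab hη (θ := ω + η) ⟨by linarith, le_rfl⟩
  have hright := isSupportPt_closedBall_inter hr (sub_eq_smul_dir_add_pi hab) hη
    (θ := ω + π - η) ⟨le_rfl, by linarith⟩
  rw [hcorner, inter_comm] at hright
  exact hleft.of_mem_Icc hright hθ (by linarith)

lemma exists_angle_of_interior_nonempty (hr : 0 < r)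
    (h : (interior (closedBall a r ∩ closedBall b r)).Nonempty) :
    ∃ ω η, 0 < η ∧ η ≤ π / 2 ∧ a - b = (2 * (r * cos η)) • dir ω := by
  obtain ⟨z, hz⟩ := h
  rw [interior_inter, interior_closedBall _ hr.ne', interior_closedBall _ hr.ne'] at hz
  have hlt : ‖a - b‖ / (2 * r) < 1 := by
    rw [div_lt_one (by positivity), two_mul, ← dist_eq_norm]
    exact (dist_triangle_right a b z).trans_lt (add_lt_add (mem_ball'.1 hz.1) (mem_ball'.1 hz.2))
  have hnonneg : 0 ≤ ‖a - b‖ / (2 * r) := by positivity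
  obtain ⟨ω, hω⟩ := exists_eq_norm_smul_dir (a - b)
  refine ⟨ω, arccos (‖a - b‖ / (2 * r)), arccos_pos.2 hlt, arccos_le_pi_div_two.2 hnonneg, ?_⟩
  rwa [cos_arccos (by linarith) hlt.le, ← mul_assoc, mul_div_cancel₀ _ (by positivity)]

lemma supportPt_eq_of_mem_arc (hlam : 0 < lam) (hK : IsLamConvexBody lam K)
    (hKab : K = closedBall a (1 / lam) ∩ closedBall b (1 / lam))
    (hab : a - b = (2 * (1 / lam * cos η)) • dir ω) (hη : η ≤ π / 2) :
    ∀ t ∈ Icc (ω - η) (ω + η), supportPt K t = b + (1 / lam) • dir t := fun t ht => by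
  have hsupp := isSupportPt_closedBall_inter (by positivity) hab hη ht
  rw [← hKab] at hsupp
  exact (hsupp.eq_supportPt hK).symm

lemma supportPt_eq_of_mem_corner (hlam : 0 < lam) (hK : IsLamConvexBody lam K)
    (hKab : K = closedBall a (1 / lam) ∩ closedBall b (1 / lam))
    (hab : a - b = (2 * (1 / lam * cos η)) • dir ω) (hη0 : 0 < η) (hη : η ≤ π / 2) :
    ∀ t ∈ Icc (ω + η) (ω + π - η),
      supportPt K t = b + (1 / lam) • dir (ω + η) + (0 : ℝ) • dir t := fun t ht => by
  have hsupp := isSupportPt_closedBall_inter_corner (by positivity) hab hη0 hη ht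
  rw [← hKab] at hsupp
  rw [zero_smul, add_zero, hsupp.eq_supportPt hK]

lemma mass_density_lens_half (hlam : 0 < lam) (hK : IsLamConvexBody lam K)
    (hKab : K = closedBall a (1 / lam) ∩ closedBall b (1 / lam))
    (hab : a - b = (2 * (1 / lam * cos η)) • dir ω) (hη0 : 0 < η) (hη : η ≤ π / 2) :
    mass (density lam K) (ω - η) (ω - η + π) = 2 * η := by
  have harc := mass_density_of_eq (lam := lam) (supportPt_eq_of_mem_arc hlam hK hKab hab hη)
    (by linarith)
  have hcorner := mass_density_of_eq (lam := lam)
    (supportPt_eq_of_mem_corner hlam hK hKab hab hη0 hη) (by linarith)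
  rw [sub_add_eq_add_sub, ← (isUnitDensity_density hlam hK).mass_add_mass _ (ω + η), harc, hcorner,
    mul_one_div_cancel hlam.ne']
  ring

lemma integral_density_mul_supportFn_lens_half (hlam : 0 < lam) (hK : IsLamConvexBody lam K)
    (hKab : K = closedBall a (1 / lam) ∩ closedBall b (1 / lam))
    (hab : a - b = (2 * (1 / lam * cos η)) • dir ω) (hη0 : 0 < η) (hη : η ≤ π / 2) :
    ∫ t in (ω - η)..(ω - η + π), density lam K t * supportFn K t
      = (∫ t in (ω - η)..(ω + η), ⟪dir t, b⟫_ℝ) + 2 * η * (1 / lam) := by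
  have hint := (isUnitDensity_density hlam hK).intervalIntegrable_mul (continuous_supportFn hK)
  have harc := integral_density_mul_supportFn_of_eq (lam := lam)
    (supportPt_eq_of_mem_arc hlam hK hKab hab hη) (by linarith)
  have hcorner := integral_density_mul_supportFn_of_eq (lam := lam)
    (supportPt_eq_of_mem_corner hlam hK hKab hab hη0 hη) (by linarith)
  rw [sub_add_eq_add_sub, ← intervalIntegral.integral_add_adjacent_intervals (hint _ (ω + η))
    (hint _ _), harc, hcorner, mul_one_div_cancel hlam.ne']
  ring

lemma integral_inner_dir_dir (ω η : ℝ) :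
    ∫ t in (ω - η)..(ω + η), ⟪dir t, dir ω⟫_ℝ = 2 * sin η := by
  simp only [inner_dir_dir]
  rw [intervalIntegral.integral_comp_sub_right, integral_cos, add_sub_cancel_left,
    sub_sub_cancel_left, sin_neg]
  ring

lemma integral_inner_dir_add_pi (x y : ℝ) (p : Plane) :
    ∫ t in (x + π)..(y + π), ⟪dir t, p⟫_ℝ = -∫ t in x..y, ⟪dir t, p⟫_ℝ := by
  rw [← intervalIntegral.integral_neg, ← intervalIntegral.integral_comp_add_right]
  simp only [dir_add_pi, inner_neg_left]

/-- On a window starting at a corner, the two arcs see opposite normals, so their centres only enter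
through the difference `a - b`. -/
lemma integral_density_mul_supportFn_lens (hlam : 0 < lam) (hK : IsLamConvexBody lam K)
    (hKab : K = closedBall a (1 / lam) ∩ closedBall b (1 / lam))
    (hab : a - b = (2 * (1 / lam * cos η)) • dir ω)
    (hη0 : 0 < η) (hη : η ≤ π / 2) :
    ∫ t in (ω - η)..(ω - η + 2 * π), density lam K t * supportFn K t
      = 1 / lam * (4 * η - 2 * sin (2 * η)) := by
  have hint := (isUnitDensity_density hlam hK).intervalIntegrable_mul (continuous_supportFn hK)
  have hinner (p : Plane) : IntervalIntegrable (fun t => ⟪dir t, p⟫_ℝ) volume (ω - η) (ω + η) :=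
    (by fun_prop : Continuous fun t => ⟪dir t, p⟫_ℝ).intervalIntegrable _ _
  have hhalf₁ := integral_density_mul_supportFn_lens_half hlam hK hKab hab hη0 hη
  have hhalf₂ := integral_density_mul_supportFn_lens_half hlam hK
    (hKab.trans (inter_comm _ _)) (sub_eq_smul_dir_add_pi hab) hη0 hη
  have hchord : (∫ t in (ω - η)..(ω + η), ⟪dir t, a⟫_ℝ) - ∫ t in (ω - η)..(ω + η), ⟪dir t, b⟫_ℝ
      = 2 * (1 / lam * cos η) * (2 * sin η) := by
    rw [← intervalIntegral.integral_sub (hinner a) (hinner b), ← integral_inner_dir_dir ω,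
      ← intervalIntegral.integral_const_mul]
    simp only [← inner_sub_right, hab, inner_smul_right]
  rw [add_sub_right_comm, add_right_comm ω π η, integral_inner_dir_add_pi] at hhalf₂
  rw [two_mul π, ← add_assoc, ← intervalIntegral.integral_add_adjacent_intervals
    (hint _ (ω - η + π)) (hint _ _), hhalf₁, hhalf₂, sin_two_mul]
  linear_combination -hchord

lemma planarArea_eq_of_isLamConvexLens (hlam : 0 < lam) (hK : IsLamConvexBody lam K)
    (h : IsLamConvexLens lam K) : planarArea K = lensArea lam (boundaryLength K) := by
  obtain ⟨hne, a, b, hKab⟩ := h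
  obtain ⟨ω, η, hη0, hη, hab⟩ :=
    exists_angle_of_interior_nonempty (one_div_pos.2 hlam) (hKab ▸ hne)
  have hmass₁ := mass_density_lens_half hlam hK hKab hab hη0 hη
  have hmass₂ := mass_density_lens_half hlam hK (hKab.trans (inter_comm _ _))
    (sub_eq_smul_dir_add_pi hab) hη0 hη
  rw [add_sub_right_comm] at hmass₂
  rw [lensArea_boundaryLength hlam hK, ← mass_add_mass_add_pi hlam hK (ω - η), hmass₁, hmass₂,
    add_self_div_two, planarArea_eq_integral_add_two_pi hlam hK (ω - η),
    integral_density_mul_supportFn_lens hlam hK hKab hab hη0 hη]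
  ring

end Lenses

end LamConvex

/-- The first conjunct says that the boundary length of `K` is finite, so that `boundaryLength K`
is the true length. -/
theorem mainTheorem7 (lam : ℝ) (hlam : 0 < lam) (K : Set (EuclideanSpace ℝ (Fin 2)))
    (hK : IsLamConvexBody lam K) :
    Measure.hausdorffMeasure 1 (frontier K) < ⊤ ∧
    planarArea K ≥ boundaryLength K / (2 * lam)
      - 1 / lam ^ 2 * Real.sin (boundaryLength K * lam / 2) ∧
    (planarArea K = boundaryLength K / (2 * lam)
      - 1 / lam ^ 2 * Real.sin (boundaryLength K * lam / 2) ↔ IsLamConvexLens lam K) := by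
  refine ⟨?_, LamConvex.lensArea_boundaryLength_le hlam hK,
    LamConvex.isLamConvexLens_of_planarArea_eq hlam hK,
    LamConvex.planarArea_eq_of_isLamConvexLens hlam hK⟩
  rw [LamConvex.hausdorffMeasure_frontier hlam hK]
  exact ENNReal.ofReal_lt_top
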